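/- Let $n\ge 0$, and let $\mathcal K$ be the closed braid projection (strands oriented upwards, closure arcs on the right, blackboard framing) of a framed link $K$ that is given by a braid word on $\mathfrak s\ge 1$ strands. Positive crossings are those at which the overcrossing strand runs from bottom left to top right; $\omega$ is the writhe. Put $v=t^{1/2}$, $\{a\}=v^a-v^{-a}$, $\{a\}_b=\prod_{s<b}\{a-s\}$, $\binom{a}{b}=\{a\}_b/\{b\}_b$, $[a]=\{a\}/\{1\}$, $(k)_u=\frac{u^k-1}{u-1}$, $\binom{a}{b}_u=\frac{(a)_u!}{(b)_u!(a-b)_u!}$, $\{a\}_{b,u}=\prod_{s=0}^{b-1}(1-u^{a-s})$. *Colored Jones polynomial.* $J'_n(K)$ is the framed colored Jones polynomial ($J'_n=1$ for the $0$-framed unknot): let $V_n$ have basis $e_0,\dots,e_n$ with $He_i=(n-2i)e_i$, $Ee_i=[n+1-i]e_{i-1}$, $Fe_i=[i+1]e_{i+1}$; positive crossings act by $R=\big(\sum_r(-1)^rv^{-r(r-1)/2}\tfrac{\{1\}^r}{[r]!}E^r\otimes F^r\big)v^{-H\otimes H/2}$ and negative ones by $v^{H\otimes H/2}\sum_r v^{r(r-1)/2}\tfrac{\{1\}^r}{[r]!}E^r\otimes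 F^r$ (first factor on the overcrossing strand), all strands but the first are closed with the weight $v^{-H}$, and $J'_n(K)$ is the coefficient at $e_0$ of the resulting endomorphism of $V_n$. *$R$-matrix state model.* Fix one of the two orientations of the closed braid (all strands upwards, or all strands downwards). The part arcs are the edges of the 4-valent graph of $\mathcal K$ together with the components without crossings. States are colorings of the part arcs by $\{0,\dots,n\}$ that satisfy the flow condition at each crossing, that do not increase along overcrossings in the direction of the orientation, and that are $0$ on the closure arc of the first strand. A state contributes $\prod_{\ell=2}^{\mathfrak s}v^{\mp(n-2b_\ell)}$ (upper sign for upwards, lower sign for downwards, $b_\ell$ the color of the $\ell$-th closure arc) times, for each crossing with left and right incoming colors $i,j$ and jump $r\ge0$, the factor $(-1)^rv^{-((n-2i)(n-2j)+r(r-1))/2}\binom{j+r}{r}\{n+r-i\}_r$ if the crossing is positive and $v^{((n-2i-2r)(n-2j+2r)+r(r-1))/2}\binom{i+r}{r}\{n+r-j\}_r$ if it is negative ("left" and "right" being taken looking in the direction of the orientation). *Arc graph.* The fat vertices of $G\mathcal K$ are the overcrossing arcs and overcrossing circles of the upwards oriented $\mathcal K$. An overcrossing arc is identified with the crossing $v$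 at which it ends, of sign $\varepsilon(v)$; it has one outgoing blue edge $e_v^b$ to the overcrossing arc that starts at $v$, and one outgoing red edge $e_v^r$ to the overcrossing arc or circle that passes over $v$. The edges into a fat vertex are ordered along the arc: first the blue edge, then the red edges in the order of the overcrossings. An $n$-flow $f$ colors the edges by nonnegative integers, with inflow equal to outflow, and at most $n$, at each fat vertex (the inflow at a circle being $0$), and each overcrossing circle by an element of $\{0,\dots,n\}$; this color counts as a first incoming edge in sums over preceding edges, but not in the inflow. For a part arc $x$, let $\phi(f)(x)$ be the sum of the colors of the edges into the fat vertex containing $x$ that precede $x$. Let $\mathcal F_n^*(G\mathcal K)$ be the set of $n$-flows for which $\phi(f)$ is $0$ on the closure arc of the first strand. Put $f(v)=f(e_v^b)+f(e_v^r)$, let $e<e_v^r$ denote the edges that precede $e_v^r$ at its target, and put $$\mathrm{exc}(f)=\sum_v\varepsilon(v)f(e_v^b)\sum_{e<e_v^r}f(e),\qquad \mathrm{rot}(f)=\sum_{\ell=2}^{\mathfrak s}\phi(f)(\ell\text{-th closure arc}),$$ $$\delta(f)=-(\mathrm{exc}(f)+\mathrm{rot}(f)),\qquad \delta'(\mathcal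 K,n)=-\tfrac{n^2}{4}\omega+\tfrac n2(\mathfrak s-1).$$ **Theorem.** 1. $J'_n(K)$ is the state sum of the $R$-matrix state model of the upwards oriented $\mathcal K$, and $$J_n'(K)=t^{\delta '(\mathcal{K},n)}\sum_{f\in \mathcal{F}_{n}^*(G\mathcal{K})}t^{\delta (f)}\prod_{v}t^{n\varepsilon (v)f(e_v^b)}\binom{f(v)}{f(e_v^b)}_{t^{-\varepsilon (v)}}\Big\{n-\sum_{e<e_v^r}f(e)\Big\}_{f(e_v^r),\,t^{\varepsilon (v)}}\in \mathbb{Z}[t^{\pm 1/4}].$$ Moreover each single contribution lies in $\mathbb Z[t^{\pm1/4}]$. 2. For $f\in\mathcal F_n^*(G\mathcal K)$ and each crossing $v$, $\phi(f)$ takes the value $f(e_v^b)$ on the undercrossing part arc that leaves $v$, and increases by $f(e_v^r)$ along the overcrossing at $v$. The map $\phi$ is a bijection from $\mathcal F_n^*(G\mathcal K)$ onto the set of states of the $R$-matrix state model of the downwards oriented $\mathcal K$ (equivalently, the $n$-bounded flows whose colors do not decrease along overcrossings in the upward direction), and the contribution of $f$ in the sum above (with the factor $t^{\delta'(\mathcal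 K,n)}$) equals the $R$-matrix contribution of $\phi(f)$. Thus the two state models are equivalent: the sets of states correspond bijectively and each contribution in one model is the sum of the contributions of the contributing states that map to it. -/

import Mathlib

namespace ColoredJones

noncomputable section

/-! ### The ground ring and quantum integers -/

/-- The field in which all state sums are evaluated: rational functions in `t^{1/4}`. -/
abbrev 𝕂 : Type := RatFunc ℚ

/-- `t^{1/4}`. -/
def tRoot : 𝕂 := RatFunc.X

/-- `v = t^{1/2}`. -/
def vv : 𝕂 := tRoot ^ 2

/-- The variable `t = v ^ 2`. -/
def tt : 𝕂 := tRoot ^ 4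

/-- The ring `ℤ[t^{±1/4}]`, as a subring of `𝕂`. -/
def laurentRing : Subring 𝕂 := Subring.closure {tRoot, tRoot⁻¹}

/-- `{a} = v^a - v^{-a}`. -/
def qBracket (a : ℤ) : 𝕂 := vv ^ a - vv ^ (-a)

/-- `[a] = {a} / {1}`. -/
def qInt (a : ℤ) : 𝕂 := qBracket a / qBracket 1

/-- `[r]! = [1] [2] ⋯ [r]`. -/
def qFactorial (r : ℕ) : 𝕂 := ∏ s ∈ Finset.range r, qInt (s + 1)

/-- `{a}_b = {a} {a - 1} ⋯ {a - b + 1}`. -/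
def qPochhammer (a : ℤ) (b : ℕ) : 𝕂 := ∏ s ∈ Finset.range b, qBracket (a - s)

/-- The balanced binomial `{a}_b / {b}_b`. -/
def qBinomial (a : ℤ) (b : ℕ) : 𝕂 := qPochhammer a b / qPochhammer b b

/-- `{a}_{b,u} = ∏_{s < b} (1 - u^{a - s})`; used for `u = t` and `u = t⁻¹`. -/
def signedPochhammer (u : 𝕂) (a : ℤ) (b : ℕ) : 𝕂 :=
  ∏ s ∈ Finset.range b, (1 - u ^ (a - s))

/-- `(a)_u! = (1)_u (2)_u ⋯ (a)_u` with `(k)_u = (u^k - 1) / (u - 1)`. -/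
def signedFactorial (u : 𝕂) (a : ℕ) : 𝕂 :=
  ∏ s ∈ Finset.range a, (u ^ (s + 1) - 1) / (u - 1)

/-- The binomial `(a)_u! / ((b)_u! (a - b)_u!)`, for `b ≤ a`. -/
def signedBinomial (u : 𝕂) (a b : ℕ) : 𝕂 :=
  signedFactorial u a / (signedFactorial u b * signedFactorial u (a - b))

/-! ### State models -/

/-- A vertex state model on a set `𝔊` of decorated graphs.  The local factors are indexed by
*sites*: the vertices of the graph and, for link projections, the extrema.  The factor at a site
`x` only depends on the colors of the edges in `near G x`: for a vertex the edges incident with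
it or with adjacent vertices, for an extremum the edges at the location of the extremum. -/
structure StateModel (𝔊 : Type) (R : Type) [CommRing R] where
  Edge : 𝔊 → Type
  Site : 𝔊 → Type
  [siteFintype : ∀ G, Fintype (Site G)]
  near : ∀ G, Site G → Set (Edge G)
  states : ∀ G, Set (Edge G → ℕ)
  globalFactor : 𝔊 → R
  siteFactor : ∀ G, Site G → (Edge G → ℕ) → R
  globalFactor_ne_zero : ∀ G, globalFactor G ≠ 0
  siteFactor_congr : ∀ G x (f g : Edge G → ℕ),
    (∀ e ∈ near G x, f e = g e) → siteFactor G x f = siteFactor G x g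
  finite_contributing :
    ∀ G, {f ∈ states G | ∏ x, siteFactor G x f ≠ 0}.Finite

attribute [instance] StateModel.siteFintype

namespace StateModel

variable {𝔊 𝔊₁ 𝔊₂ R : Type} [CommRing R]

/-- `β(f)`, the product of the local factors. -/
def localFactor (Z : StateModel 𝔊 R) (G : 𝔊) (f : Z.Edge G → ℕ) : R :=
  ∏ x, Z.siteFactor G x f

/-- The contribution `Z(f) = Δ β(f)` of a state. -/
def contribution (Z : StateModel 𝔊 R) (G : 𝔊) (f : Z.Edge G → ℕ) : R :=
  Z.globalFactor G * Z.localFactor G f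

/-- The contributing states: those with `β(f) ≠ 0`. -/
def contributing (Z : StateModel 𝔊 R) (G : 𝔊) : Set (Z.Edge G → ℕ) :=
  {f ∈ Z.states G | Z.localFactor G f ≠ 0}

/-- The state sum. -/
def stateSum (Z : StateModel 𝔊 R) (G : 𝔊) : R :=
  ∑ᶠ f ∈ Z.states G, Z.contribution G f

/-- `Z₁` dominates `Z₂` over `(Φ, φ)`. -/
def DominatesOver (Z₁ : StateModel 𝔊₁ R) (Z₂ : StateModel 𝔊₂ R) (Φ : 𝔊₁ → 𝔊₂)
    (φ : ∀ G, (Z₁.Edge G → ℕ) → (Z₂.Edge (Φ G) → ℕ)) : Prop :=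
  ∀ G, Set.MapsTo (φ G) (Z₁.states G) (Z₂.states (Φ G)) ∧
    Set.SurjOn (φ G) (Z₁.states G) (Z₂.states (Φ G)) ∧
    ∀ f ∈ Z₂.states (Φ G),
      Z₂.contribution (Φ G) f =
        ∑ᶠ g ∈ {g | g ∈ Z₁.contributing G ∧ φ G g = f}, Z₁.contribution G g

/-- `Z₁` and `Z₂` are equivalent over `Φ`, through the bijections `φ` of sets of states. -/
def EquivalentOver (Z₁ : StateModel 𝔊₁ R) (Z₂ : StateModel 𝔊₂ R) (Φ : 𝔊₁ → 𝔊₂)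
    (φ : ∀ G, (Z₁.Edge G → ℕ) → (Z₂.Edge (Φ G) → ℕ)) : Prop :=
  Z₁.DominatesOver Z₂ Φ φ ∧ ∀ G, Set.BijOn (φ G) (Z₁.states G) (Z₂.states (Φ G))

end StateModel

/-! ### Closed braid projections and their part arc-graphs -/

/-- A braid word on `m + 1` strands.  The letter `(k, ε)` is the generator `σ_{k+1}^ε`, which
crosses the strands at the positions `k` and `k + 1` (counted from `0`, from left to right).
Words are read from left to right as the braid is read from bottom to top, strands are oriented
upwards, and the closure arcs run around the right of the braid.  At a positive crossing the
overcrossing strand runs from bottom left to top right. -/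
abbrev BraidWord (m : ℕ) : Type := List (Fin m × ℤˣ)

variable {m : ℕ}

/-- The crossings of the projection, from bottom to top. -/
abbrev Crossing (β : BraidWord m) : Type := Fin β.length

/-- The left one of the two positions at which the crossing takes place. -/
def gen (β : BraidWord m) (k : Crossing β) : Fin m := (β.get k).1

/-- The sign of a crossing. -/
def sgn (β : BraidWord m) (k : Crossing β) : ℤˣ := (β.get k).2

/-- The writhe of the projection. -/
def writhe (β : BraidWord m) : ℤ := ∑ k : Crossing β, (sgn β k : ℤ)

/-- A point of the braid: a level (level `k` is just below the `k`-th crossing, the last level is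
the top of the braid) together with a horizontal position. -/
abbrev Point (β : BraidWord m) : Type := Fin (β.length + 1) × Fin (m + 1)

/-- Points joined by a piece of the closed braid that contains no crossing. -/
inductive Joined (β : BraidWord m) : Point β → Point β → Prop
  | through (k : Crossing β) (p : Fin (m + 1))
      (h₁ : p ≠ (gen β k).castSucc) (h₂ : p ≠ (gen β k).succ) :
      Joined β (k.castSucc, p) (k.succ, p)
  | closing (p : Fin (m + 1)) : Joined β (Fin.last _, p) (0, p)

/-- The part arcs of the closed braid: the edges of the part arc-graph, and the components
without crossings. -/
def PartArc (β : BraidWord m) : Type := Quot (Joined β)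

/-- The part arc through a point. -/
def partArc (β : BraidWord m) (x : Point β) : PartArc β := Quot.mk _ x

instance (β : BraidWord m) : Finite (PartArc β) :=
  Finite.of_surjective (partArc β) Quot.mk_surjective

/-- The overcrossing part arc entering a crossing (from below). -/
def overIn (β : BraidWord m) (k : Crossing β) : PartArc β :=
  partArc β (k.castSucc, if sgn β k = 1 then (gen β k).castSucc else (gen β k).succ)

/-- The overcrossing part arc leaving a crossing (to the top). -/
def overOut (β : BraidWord m) (k : Crossing β) : PartArc β :=
  partArc β (k.succ, if sgn β k = 1 then (gen β k).succ else (gen β k).castSucc)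

/-- The undercrossing part arc entering a crossing (from below). -/
def underIn (β : BraidWord m) (k : Crossing β) : PartArc β :=
  partArc β (k.castSucc, if sgn β k = 1 then (gen β k).succ else (gen β k).castSucc)

/-- The undercrossing part arc leaving a crossing (to the top). -/
def underOut (β : BraidWord m) (k : Crossing β) : PartArc β :=
  partArc β (k.succ, if sgn β k = 1 then (gen β k).castSucc else (gen β k).succ)

/-- The part arc that contains the closure arc of the strand at position `p`. -/
def closureArc (β : BraidWord m) (p : Fin (m + 1)) : PartArc β := partArc β (0, p)

/-- The projections under consideration: braid words on any number of strands. -/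
abbrev Projection : Type := (m : ℕ) × BraidWord m

/-! ### The framed colored Jones polynomial

The irreducible representation of dimension `n + 1` has the basis `e_0, …, e_n`, on which the
quantum group acts by `H e_i = (n - 2i) e_i`, `E e_i = [n + 1 - i] e_{i-1}` and
`F e_i = [i + 1] e_{i+1}`. -/

/-- The matrix of `E`. -/
def matE (n : ℕ) : Matrix (Fin (n + 1)) (Fin (n + 1)) 𝕂 :=
  fun a i => if (a : ℕ) + 1 = i then qInt (n + 1 - (i : ℕ)) else 0

/-- The matrix of `F`. -/
def matF (n : ℕ) : Matrix (Fin (n + 1)) (Fin (n + 1)) 𝕂 :=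
  fun a i => if (a : ℕ) = i + 1 then qInt ((i : ℕ) + 1) else 0

/-- The weight of `H` on `e_i`. -/
def wt (n : ℕ) (i : Fin (n + 1)) : ℤ := (n : ℤ) - 2 * (i : ℕ)

/-- `v ^ (c H ⊗ H / 2)` for an integer `c`. -/
def cartanPart (n : ℕ) (c : ℤ) :
    Matrix (Fin (n + 1) × Fin (n + 1)) (Fin (n + 1) × Fin (n + 1)) 𝕂 :=
  Matrix.diagonal fun x => tRoot ^ (c * (wt n x.1 * wt n x.2))

open scoped Kronecker in
/-- The action of the universal `R`-matrix,
`(∑_r (-1)^r v^{-r(r-1)/2} {1}^r / [r]! • E^r ⊗ F^r) v^{-H ⊗ H / 2}`.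
The first tensor factor belongs to the overcrossing strand. -/
def matR (n : ℕ) : Matrix (Fin (n + 1) × Fin (n + 1)) (Fin (n + 1) × Fin (n + 1)) 𝕂 :=
  (∑ r ∈ Finset.range (n + 1),
    ((-1) ^ r * tRoot ^ (-((r : ℤ) * (r - 1))) * qBracket 1 ^ r / qFactorial r) •
      ((matE n ^ r) ⊗ₖ (matF n ^ r))) * cartanPart n (-1)

open scoped Kronecker in
/-- The action of the inverse of the universal `R`-matrix,
`v^{H ⊗ H / 2} ∑_r v^{r(r-1)/2} {1}^r / [r]! • E^r ⊗ F^r`. -/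
def matRInv (n : ℕ) : Matrix (Fin (n + 1) × Fin (n + 1)) (Fin (n + 1) × Fin (n + 1)) 𝕂 :=
  cartanPart n 1 * ∑ r ∈ Finset.range (n + 1),
    (tRoot ^ ((r : ℤ) * (r - 1)) * qBracket 1 ^ r / qFactorial r) •
      ((matE n ^ r) ⊗ₖ (matF n ^ r))

/-- The operator of a crossing of sign `ε`.  The pair `x` consists of the left and right incoming
indices (at the bottom), `y` of the left and right outgoing ones (at the top). -/
def braiding (n : ℕ) (ε : ℤˣ) :
    Matrix (Fin (n + 1) × Fin (n + 1)) (Fin (n + 1) × Fin (n + 1)) 𝕂 :=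
  fun y x => if ε = 1 then matR n (y.2, y.1) (x.1, x.2) else matRInv n (y.1, y.2) (x.2, x.1)

/-- The operator of a braid generator on the tensor power of the representation, whose basis
is indexed by the maps from the strand positions to the basis of the representation. -/
def letterOp (n : ℕ) (g : Fin m × ℤˣ) :
    Matrix (Fin (m + 1) → Fin (n + 1)) (Fin (m + 1) → Fin (n + 1)) 𝕂 :=
  open Classical in
  fun y x =>
    if ∀ p, p ≠ g.1.castSucc → p ≠ g.1.succ → y p = x p then
      braiding n g.2 (y g.1.castSucc, y g.1.succ) (x g.1.castSucc, x g.1.succ)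
    else 0

/-- The operator of a braid; the first letter of the word acts first. -/
def braidOp (n : ℕ) (β : BraidWord m) :
    Matrix (Fin (m + 1) → Fin (n + 1)) (Fin (m + 1) → Fin (n + 1)) 𝕂 :=
  (β.map (letterOp n)).reverse.prod

/-- The endomorphism of the representation that belongs to the long component projection in which
all strands but the first are closed: the partial quantum trace of the operator of the braid. -/
def tangleOp (n : ℕ) (β : BraidWord m) : Matrix (Fin (n + 1)) (Fin (n + 1)) 𝕂 :=
  fun a i => ∑ x : Fin m → Fin (n + 1),
    (∏ p, vv ^ (-wt n (x p))) * braidOp n β (Fin.cons a x) (Fin.cons i x)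

/-- The framed colored Jones polynomial `J'_n` of the closure of `β` with blackboard framing,
with value `1` on the trivially framed unknot: the coefficient at `e_0` of the (scalar)
endomorphism of the long component projection. -/
def coloredJones (n : ℕ) (β : BraidWord m) : 𝕂 := tangleOp n β 0 0

/-! ### The `R`-matrix state model on part arc-graphs -/

/-- `f_+(n,i,j,r) = (-1)^r v^{-((n-2i)(n-2j)+r(r-1))/2} (j+r choose r) {n+r-i}_r`. -/
def fPlus (n i j r : ℕ) : 𝕂 :=
  (-1) ^ r * tRoot ^ (-(((n : ℤ) - 2 * i) * (n - 2 * j) + r * (r - 1))) *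
    qBinomial (j + r) r * qPochhammer ((n : ℤ) + r - i) r

/-- `f_-(n,i,j,r) = v^{((n-2i-2r)(n-2j+2r)+r(r-1))/2} (i+r choose r) {n+r-j}_r`. -/
def fMinus (n i j r : ℕ) : 𝕂 :=
  tRoot ^ (((n : ℤ) - 2 * i - 2 * r) * (n - 2 * j + 2 * r) + r * (r - 1)) *
    qBinomial (i + r) r * qPochhammer ((n : ℤ) + r - j) r

/-- The two orientations of a closed braid: all strands run upwards, or all run downwards.
Signs of crossings are the same for both. -/
inductive Orient
  | up
  | down

/-- The overcrossing part arc that enters a crossing with respect to the orientation. -/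
def overSrc (o : Orient) (β : BraidWord m) (k : Crossing β) : PartArc β :=
  match o with
  | .up => overIn β k
  | .down => overOut β k

/-- The overcrossing part arc that leaves a crossing with respect to the orientation. -/
def overTgt (o : Orient) (β : BraidWord m) (k : Crossing β) : PartArc β :=
  match o with
  | .up => overOut β k
  | .down => overIn β k

/-- The undercrossing part arc that enters a crossing with respect to the orientation. -/
def underSrc (o : Orient) (β : BraidWord m) (k : Crossing β) : PartArc β :=
  match o with
  | .up => underIn β k
  | .down => underOut β k

/-- The undercrossing part arc that leaves a crossing with respect to the orientation. -/
def underTgt (o : Orient) (β : BraidWord m) (k : Crossing β) : PartArc β :=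
  match o with
  | .up => underOut β k
  | .down => underIn β k

/-- The exponent of `v` contributed by a closure arc of color `b`. -/
def extremumExp (o : Orient) (n b : ℕ) : ℤ :=
  match o with
  | .up => -(n : ℤ) + 2 * b
  | .down => (n : ℤ) - 2 * b

/-- The `n`-bounded flows on the part arc-graph whose colors decrease along the overcrossing arcs
at all crossings, and which have color `0` on the closure arc of the first strand.  With respect
to the orientation `down` these are the flows whose colors increase along the overcrossing
arcs of the upwards oriented braid. -/
def partStates (o : Orient) (n : ℕ) (β : BraidWord m) : Set (PartArc β → ℕ) :=
  {s | (∀ e, s e ≤ n) ∧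
    (∀ k, s (overSrc o β k) + s (underSrc o β k) = s (overTgt o β k) + s (underTgt o β k)) ∧
    (∀ k, s (overTgt o β k) ≤ s (overSrc o β k)) ∧
    s (closureArc β 0) = 0}

/-- The contribution of a crossing: `f_+` or `f_-` at the colors of the left and right incoming
part arcs and the jump.  The overcrossing part arc enters from the left at a positive and from
the right at a negative crossing. -/
def crossingFactor (o : Orient) (n : ℕ) (β : BraidWord m) (k : Crossing β)
    (s : PartArc β → ℕ) : 𝕂 :=
  if sgn β k = 1 then
    fPlus n (s (overSrc o β k)) (s (underSrc o β k)) (s (overSrc o β k) - s (overTgt o β k))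
  else
    fMinus n (s (underSrc o β k)) (s (overSrc o β k)) (s (overSrc o β k) - s (overTgt o β k))

theorem partStates_finite (o : Orient) (n : ℕ) (β : BraidWord m) :
    (partStates o n β).Finite :=
  (Set.Finite.pi' (fun _ => Set.finite_Iic n)).subset fun _ hs e => hs.1 e

/-- The `R`-matrix state model for the closed braids with orientation `o`.  The sites are
the crossings and the closure arcs of all strands but the first. -/
def rMatrixModel (o : Orient) (n : ℕ) : StateModel Projection 𝕂 where
  Edge K := PartArc K.2
  Site K := Crossing K.2 ⊕ Fin K.1
  siteFintype _ := inferInstance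
  near K x := match x with
    | .inl k => {overSrc o K.2 k, underSrc o K.2 k, overTgt o K.2 k, underTgt o K.2 k}
    | .inr p => {closureArc K.2 p.succ}
  states K := partStates o n K.2
  globalFactor _ := 1
  siteFactor K x s := match x with
    | .inl k => crossingFactor o n K.2 k s
    | .inr p => vv ^ extremumExp o n (s (closureArc K.2 p.succ))
  globalFactor_ne_zero _ := one_ne_zero
  siteFactor_congr K x f g h := by
    rcases x with k | p
    · have h₁ := h (overSrc o K.2 k) (by simp)
      have h₂ := h (underSrc o K.2 k) (by simp)
      have h₃ := h (overTgt o K.2 k) (by simp)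
      simp [crossingFactor, h₁, h₂, h₃]
    · have h₁ := h (closureArc K.2 p.succ) (by simp)
      simp [h₁]
  finite_contributing K := (partStates_finite o n K.2).subset fun _ hf => hf.1

/-! ### Arc graphs -/

/-- Part arcs that follow each other along an overcrossing arc. -/
inductive OverStep (β : BraidWord m) : PartArc β → PartArc β → Prop
  | over (k : Crossing β) : OverStep β (overIn β k) (overOut β k)

/-- The fat vertices of the arc graph: the overcrossing arcs and overcrossing circles. -/
def OverArc (β : BraidWord m) : Type := Quot (OverStep β)

/-- The overcrossing arc or circle that contains a part arc. -/
def overArc (β : BraidWord m) (x : PartArc β) : OverArc β := Quot.mk _ x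

instance (β : BraidWord m) : Finite (OverArc β) :=
  Finite.of_surjective (overArc β) Quot.mk_surjective

/-- The part arc `x` precedes or equals the part arc `y` along an overcrossing arc. -/
def Precedes (β : BraidWord m) : PartArc β → PartArc β → Prop :=
  Relation.ReflTransGen (OverStep β)

/-- The overcrossing arc that ends at (the undercrossing of) a crossing: the common source of the
blue and red edges that belong to this crossing. -/
def arcEnding (β : BraidWord m) (k : Crossing β) : OverArc β := overArc β (underIn β k)

/-- The target of the blue edge: the overcrossing arc that starts at the crossing. -/
def blueTarget (β : BraidWord m) (k : Crossing β) : OverArc β := overArc β (underOut β k)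

/-- The target of the red edge: the overcrossing arc or circle that passes over the crossing. -/
def redTarget (β : BraidWord m) (k : Crossing β) : OverArc β := overArc β (overIn β k)

/-- The overcrossing circles: no overcrossing arc ends there. -/
def IsOverCircle (β : BraidWord m) (w : OverArc β) : Prop := ∀ k, arcEnding β k ≠ w

/-- The colored items of the arc graph.  The vertices of the arc graph that are overcrossing arcs
are identified with the crossings at which they end; there is one outgoing blue and one
outgoing red edge for each of them.  In addition each overcrossing circle carries a color. -/
inductive ArcEdge (β : BraidWord m) : Type
  | blue (k : Crossing β)
  | red (k : Crossing β)
  | circle (w : {w : OverArc β // IsOverCircle β w})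

/-- The sum of the colors of the edges that enter a fat vertex. -/
def inFlow (β : BraidWord m) (f : ArcEdge β → ℕ) (w : OverArc β) : ℕ :=
  open Classical in
  (∑ k with blueTarget β k = w, f (.blue k)) + ∑ k with redTarget β k = w, f (.red k)

/-- The sum of the colors of the edges that leave a fat vertex. -/
def outFlow (β : BraidWord m) (f : ArcEdge β → ℕ) (w : OverArc β) : ℕ :=
  open Classical in
  ∑ k with arcEnding β k = w, (f (.blue k) + f (.red k))

/-- For a part arc `x` in the boundary of a fat vertex, the sum of the colors of the edges into
the fat vertex that precede `x`.  The incoming blue edge comes first, followed by the red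
edges in the order of the overcrossings; at an overcrossing circle, the color of the
circle takes the place of the blue edge. -/
def precedingSum (β : BraidWord m) (f : ArcEdge β → ℕ) (x : PartArc β) : ℕ :=
  open Classical in
  (∑ k with blueTarget β k = overArc β x, f (.blue k)) +
    (if h : IsOverCircle β (overArc β x) then f (.circle ⟨overArc β x, h⟩) else 0) +
    ∑ k with Precedes β (overOut β k) x, f (.red k)

/-- The `n`-flows on the arc graph (with colors at most `n` on the overcrossing circles) that
give color `0` to the closure arc of the first strand. -/
def arcStates (n : ℕ) (β : BraidWord m) : Set (ArcEdge β → ℕ) :=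
  {f | (∀ w, inFlow β f w = outFlow β f w ∧ outFlow β f w ≤ n) ∧ (∀ w, f (.circle w) ≤ n) ∧
    precedingSum β f (closureArc β 0) = 0}

/-- `∑_{e < e_v^r} f(e)`: the sum of the colors of the edges that enter the target of the red edge
at `v` before this red edge does. -/
def beforeRed (β : BraidWord m) (f : ArcEdge β → ℕ) (k : Crossing β) : ℕ :=
  precedingSum β f (overIn β k)

/-- The excess of a state. -/
def exc (β : BraidWord m) (f : ArcEdge β → ℕ) : ℤ :=
  ∑ k, (sgn β k : ℤ) * f (.blue k) * beforeRed β f k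

/-- The rotation of a state: the sum of the colors of the closure arcs of all strands but
the first. -/
def rot (β : BraidWord m) (f : ArcEdge β → ℕ) : ℤ :=
  ∑ p : Fin m, (precedingSum β f (closureArc β p.succ) : ℤ)

/-- `δ(f) = -(exc(f) + rot(f))`. -/
def delta (β : BraidWord m) (f : ArcEdge β → ℕ) : ℤ := -(exc β f + rot β f)

/-- `4 δ'`, where `δ' = -(n²/4) ω + (n/2) (𝔰 - 1)` and `𝔰 = m + 1` is the number of strands. -/
def fourDeltaPrime (n : ℕ) (β : BraidWord m) : ℤ :=
  -(n : ℤ) ^ 2 * writhe β + 2 * n * m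

/-- The factor of a vertex `v` of the arc graph,
`t^{n ε(v) f(e_v^b)} (f(v) choose f(e_v^b))_{t^{-ε(v)}} {n - ∑_{e < e_v^r} f(e)}_{f(e_v^r), t^{ε(v)}}`
with `f(v) = f(e_v^b) + f(e_v^r)`. -/
def vertexFactor (n : ℕ) (β : BraidWord m) (f : ArcEdge β → ℕ) (k : Crossing β) : 𝕂 :=
  tt ^ ((n : ℤ) * (sgn β k : ℤ) * f (.blue k)) *
    signedBinomial (tt ^ (-(sgn β k : ℤ))) (f (.blue k) + f (.red k)) (f (.blue k)) *
    signedPochhammer (tt ^ (sgn β k : ℤ)) ((n : ℤ) - beforeRed β f k) (f (.red k))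

/-- The map of the flow lemma, from colorings of the arc graph to colorings of the
part arc-graph. -/
def flowMap (β : BraidWord m) (f : ArcEdge β → ℕ) : PartArc β → ℕ := precedingSum β f

/-- Incidence of edges and vertices in the arc graph. -/
def Incident (β : BraidWord m) (e : ArcEdge β) (w : OverArc β) : Prop :=
  match e with
  | .blue k => arcEnding β k = w ∨ blueTarget β k = w
  | .red k => arcEnding β k = w ∨ redTarget β k = w
  | .circle c => c.1 = w

/-- Vertices of the arc graph that are joined by an edge. -/
def Adjacent (β : BraidWord m) (w w' : OverArc β) : Prop :=
  ∃ e, Incident β e w ∧ Incident β e w'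

theorem overArc_eq_of_precedes {β : BraidWord m} {x y : PartArc β} (h : Precedes β x y) :
    overArc β x = overArc β y := by
  induction h with
  | refl => rfl
  | tail _ h ih => exact ih.trans (Quot.sound h)

theorem precedingSum_congr {β : BraidWord m} {f g : ArcEdge β → ℕ} {x : PartArc β}
    (h : ∀ e, Incident β e (overArc β x) → f e = g e) :
    precedingSum β f x = precedingSum β g x := by
  unfold precedingSum
  congr 1
  · congr 1
    · refine Finset.sum_congr rfl fun k hk => h _ ?_
      exact Or.inr (by simpa using hk)
    · split_ifs with hc
      · exact h _ rfl
      · rfl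
  · refine Finset.sum_congr rfl fun k hk => h _ ?_
    right
    have hk' : Precedes β (overOut β k) x := by simpa using hk
    rw [← overArc_eq_of_precedes hk']
    exact Quot.sound (OverStep.over k)

theorem arcStates_finite (n : ℕ) (β : BraidWord m) : (arcStates n β).Finite := by
  have : Finite (ArcEdge β) := by
    refine Finite.of_surjective
      (fun x : Crossing β ⊕ Crossing β ⊕ {w : OverArc β // IsOverCircle β w} =>
        match x with
        | .inl k => ArcEdge.blue k
        | .inr (.inl k) => ArcEdge.red k
        | .inr (.inr w) => ArcEdge.circle w) ?_
    rintro (k | k | w)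
    · exact ⟨.inl k, rfl⟩
    · exact ⟨.inr (.inl k), rfl⟩
    · exact ⟨.inr (.inr w), rfl⟩
  refine (Set.Finite.pi' (fun _ => Set.finite_Iic n)).subset ?_
  rintro f ⟨h, hc, -⟩ e
  have key (k : Crossing β) : f (.blue k) + f (.red k) ≤ n := by
    classical
    refine le_trans ?_ (h (arcEnding β k)).2
    unfold outFlow
    exact Finset.single_le_sum (f := fun k => f (.blue k) + f (.red k))
      (fun _ _ => Nat.zero_le _) (by simp)
  rcases e with k | k | w
  · exact (Nat.le_add_right _ _).trans (key k)
  · exact (Nat.le_add_left _ _).trans (key k)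
  · exact hc w

/-- The state model on arc graphs.  The sites are the vertices that are overcrossing arcs,
identified with the crossings, and the closure arcs of all strands but the first. -/
def arcModel (n : ℕ) : StateModel Projection 𝕂 where
  Edge K := ArcEdge K.2
  Site K := Crossing K.2 ⊕ Fin K.1
  siteFintype _ := inferInstance
  near K x := match x with
    | .inl k => {e | ∃ w, (w = arcEnding K.2 k ∨ Adjacent K.2 (arcEnding K.2 k) w) ∧
        Incident K.2 e w}
    | .inr p => {e | Incident K.2 e (overArc K.2 (closureArc K.2 p.succ))}
  states K := arcStates n K.2
  globalFactor K := tRoot ^ fourDeltaPrime n K.2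
  siteFactor K x f := match x with
    | .inl k => tt ^ (-((sgn K.2 k : ℤ) * f (.blue k) * beforeRed K.2 f k)) *
        vertexFactor n K.2 f k
    | .inr p => tt ^ (-(precedingSum K.2 f (closureArc K.2 p.succ) : ℤ))
  globalFactor_ne_zero _ := zpow_ne_zero _ RatFunc.X_ne_zero
  siteFactor_congr K x f g h := by
    rcases x with k | p
    · have hb : f (.blue k) = g (.blue k) := h _ ⟨_, Or.inl rfl, Or.inl rfl⟩
      have hr : f (.red k) = g (.red k) := h _ ⟨_, Or.inl rfl, Or.inl rfl⟩
      have hs : beforeRed K.2 f k = beforeRed K.2 g k :=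
        precedingSum_congr fun e he =>
          h e ⟨redTarget K.2 k, Or.inr ⟨.red k, Or.inl rfl, Or.inr rfl⟩, he⟩
      simp only [vertexFactor, hb, hr, hs]
    · have hs : precedingSum K.2 f (closureArc K.2 p.succ) =
          precedingSum K.2 g (closureArc K.2 p.succ) := precedingSum_congr fun e he => h e he
      simp only [hs]
  finite_contributing K := (arcStates_finite n K.2).subset fun _ hf => hf.1

theorem tt_ne_zero : tt ≠ 0 := pow_ne_zero _ RatFunc.X_ne_zero

theorem tt_zpow_sum {ι : Type} (s : Finset ι) (a : ι → ℤ) :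
    tt ^ (∑ i ∈ s, a i) = ∏ i ∈ s, tt ^ a i := by
  classical
  induction s using Finset.induction_on with
  | empty => simp
  | insert i s hi ih =>
    rw [Finset.sum_insert hi, Finset.prod_insert hi, zpow_add₀ tt_ne_zero, ih]

/-- The contribution of a state in the state model on arc graphs, in closed form. -/
theorem arcModel_contribution (n : ℕ) (β : BraidWord m) (f : ArcEdge β → ℕ) :
    (arcModel n).contribution ⟨m, β⟩ f =
      tRoot ^ fourDeltaPrime n β * (tt ^ delta β f * ∏ k, vertexFactor n β f k) := by
  have hd : tt ^ delta β f =
      (∏ k, tt ^ (-((sgn β k : ℤ) * f (.blue k) * beforeRed β f k))) *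
        ∏ p : Fin m, tt ^ (-(precedingSum β f (closureArc β p.succ) : ℤ)) := by
    rw [← tt_zpow_sum, ← tt_zpow_sum, ← zpow_add₀ tt_ne_zero]
    simp only [delta, exc, rot, Finset.sum_neg_distrib, neg_add]
  have hl : (arcModel n).localFactor ⟨m, β⟩ f =
      ∏ x : Crossing β ⊕ Fin m, (arcModel n).siteFactor ⟨m, β⟩ x f := rfl
  have hc : (arcModel n).contribution ⟨m, β⟩ f =
      tRoot ^ fourDeltaPrime n β * (arcModel n).localFactor ⟨m, β⟩ f := rfl
  rw [hc, hl, Fintype.prod_sum_type, hd]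
  simp only [arcModel, Finset.prod_mul_distrib]
  ring

end

end ColoredJones

/-!
Three sums have to agree: the colored Jones polynomial `tangleOp n β 0 0`, the `R`-matrix state sums
of the two orientations, and the sum over flows on the arc graph.

*Operators and the upward orientation.* The powers of `E` and `F` are explicit, so the entries of
the `R`-matrix and of its inverse are the factors `f_±` (`matR_apply`, `matRInv_apply`).  Expanding
the product of the letters over paths of basis vectors, and noting that a path contributes only
if it is constant along the pieces of strands without crossings, one obtains every diagonal entry of
`tangleOp` as a sum over colorings of the part arcs (`tangleOp_apply_self_eq_sum`).  The entry at
`e_0` is the state sum of the upwards oriented braid.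

*The downward orientation.* Rotating a crossing by a half turn amounts to the replacement of
each color `a` by `n - a`, up to conjugation by the diagonal matrix `gauge` (`crossingEntry_rev`).
The conjugation cancels around the closed braid, so that the downward state sum is the entry of
`tangleOp` at the lowest weight vector `e_n`.  It agrees with the entry at `e_0` because `tangleOp`
commutes with `F` (`tangleOp_mul_matF`): the braiding commutes with the coproduct
`F ⊗ K⁻¹ + 1 ⊗ F` (`commute_braiding_coprodF`), hence the operator of the braid commutes with the
iterated coproduct, and the partial trace of this relation is the claim.

*Arc graph.* Following strands through the braid is a partial injection on a finite set, and so is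
following part arcs along overcrossings.  The orbits are paths, the overcrossing arcs, or
cycles, the overcrossing circles; no red edge into a circle carries a color.  The color of the blue
edge at `v` is the color of the undercrossing part arc that leaves `v`, and the color of the red
edge is the jump along the overcrossing.  These values determine the flow, which gives
`flowMap_bijOn`.  The factors of a crossing in the two models differ by a power of `t^{1/4}` whose
exponent is the change, from below to above the crossing, of `∑_p (2 n p c_p + c_p²)`, where `c_p`
is the color at position `p`; such changes add up to zero around the closed braid
(`sum_crossings_eq_zero`), whence `contribution_flowMap`.  Integrality is visible in the arc model,
since Gaussian binomials are polynomials.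
-/

namespace ColoredJones

noncomputable section

variable {m : ℕ}

open scoped Kronecker

/-! ### Relations that are graphs of partial injections -/

section PartialInjection

open Relation

variable {α : Type*} {r : α → α → Prop}

/-- Along a functional relation, equivalent elements flow together. -/
theorem exists_common_target (hr : Relator.RightUnique r) {x y : α}
    (h : Quot.mk r x = Quot.mk r y) : ∃ z, ReflTransGen r x z ∧ ReflTransGen r y z := by
  have h' := Quot.eqvGen_exact h
  clear h
  induction h' with
  | rel x y h => exact ⟨y, .single h, .refl⟩
  | refl x => exact ⟨x, .refl, .refl⟩
  | symm x y _ ih => obtain ⟨z, h₁, h₂⟩ := ih; exact ⟨z, h₂, h₁⟩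
  | trans x y w _ _ ih₁ ih₂ =>
    obtain ⟨z₁, h₁, h₂⟩ := ih₁
    obtain ⟨z₂, h₃, h₄⟩ := ih₂
    rcases ReflTransGen.total_of_right_unique hr h₂ h₃ with h | h
    · exact ⟨z₂, h₁.trans h, h₄⟩
    · exact ⟨z₁, h₁, h₄.trans h⟩

theorem exists_common_source (hl : Relator.LeftUnique r) {x y : α}
    (h : Quot.mk r x = Quot.mk r y) : ∃ z, ReflTransGen r z x ∧ ReflTransGen r z y := by
  have hs : Quot.mk (Function.swap r) x = Quot.mk (Function.swap r) y := by
    have h' := Quot.eqvGen_exact h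
    clear h
    induction h' with
    | rel x y h => exact (Quot.sound (r := Function.swap r) h).symm
    | refl x => rfl
    | symm x y _ ih => exact ih.symm
    | trans x y w _ _ ih₁ ih₂ => exact ih₁.trans ih₂
  obtain ⟨z, h₁, h₂⟩ := exists_common_target (r := Function.swap r) (fun _ _ _ h₁ h₂ => hl h₁ h₂) hs
  exact ⟨z, reflTransGen_swap.1 h₁, reflTransGen_swap.1 h₂⟩

theorem eq_of_reflTransGen_of_sink {x y : α} (hx : ∀ z, ¬ r x z) (h : ReflTransGen r x y) :
    y = x := by
  rcases h.cases_head with h | ⟨z, hz, -⟩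
  · exact h.symm
  · exact absurd hz (hx z)

theorem eq_of_reflTransGen_of_source {x y : α} (hy : ∀ z, ¬ r z y) (h : ReflTransGen r x y) :
    x = y := by
  rcases h.cases_tail with h | ⟨z, -, hz⟩
  · exact h.symm
  · exact absurd hz (hy z)

theorem reflTransGen_of_sink (hr : Relator.RightUnique r) {x y : α}
    (h : Quot.mk r x = Quot.mk r y) (hy : ∀ z, ¬ r y z) : ReflTransGen r x y := by
  obtain ⟨z, h₁, h₂⟩ := exists_common_target hr h
  rwa [eq_of_reflTransGen_of_sink hy h₂] at h₁

theorem reflTransGen_of_source (hl : Relator.LeftUnique r) {x y : α}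
    (h : Quot.mk r x = Quot.mk r y) (hx : ∀ z, ¬ r z x) : ReflTransGen r x y := by
  obtain ⟨z, h₁, h₂⟩ := exists_common_source hl h
  rwa [eq_of_reflTransGen_of_source hx h₁] at h₂

theorem eq_of_sinks (hr : Relator.RightUnique r) {x y : α}
    (h : Quot.mk r x = Quot.mk r y) (hx : ∀ z, ¬ r x z) (hy : ∀ z, ¬ r y z) : x = y :=
  (eq_of_reflTransGen_of_sink hx (reflTransGen_of_sink hr h hy)).symm

theorem eq_of_sources (hl : Relator.LeftUnique r) {x y : α}
    (h : Quot.mk r x = Quot.mk r y) (hx : ∀ z, ¬ r z x) (hy : ∀ z, ¬ r z y) : x = y :=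
  eq_of_reflTransGen_of_source hy (reflTransGen_of_source hl h hx)

/-- The orbits of a partial injection of a finite set are paths and cycles: whoever does not
run into a sink returns to its starting point. -/
theorem exists_sink_or_cycle [Finite α] (hl : Relator.LeftUnique r) (x : α) :
    (∃ y, ReflTransGen r x y ∧ ∀ z, ¬ r y z) ∨ TransGen r x x := by
  by_contra! hc
  obtain ⟨hs, hx⟩ := hc
  have hs' : ∀ y : {y // ReflTransGen r x y}, ∃ z : {y // ReflTransGen r x y}, r y z := by
    rintro ⟨y, hy⟩
    obtain ⟨z, hz⟩ := hs y hy
    exact ⟨⟨z, hy.tail hz⟩, hz⟩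
  choose f hf using hs'
  have hinj : Function.Injective f := fun a b hab =>
    Subtype.ext (hl (hf a) (by rw [hab]; exact hf b))
  obtain ⟨y, hy⟩ := (Finite.injective_iff_surjective.1 hinj) ⟨x, .refl⟩
  have hyx : r y x := by simpa [hy] using hf y
  exact hx (TransGen.tail' y.2 hyx)

theorem exists_source_or_cycle [Finite α] (hr : Relator.RightUnique r) (x : α) :
    (∃ y, ReflTransGen r y x ∧ ∀ z, ¬ r z y) ∨ TransGen r x x := by
  rcases exists_sink_or_cycle (r := Function.swap r) (fun _ _ _ h₁ h₂ => hr h₁ h₂) x with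
    ⟨y, h, hy⟩ | h
  · exact .inl ⟨y, reflTransGen_swap.1 h, hy⟩
  · exact .inr (transGen_swap.1 h)

theorem not_cycle_of_sink (hr : Relator.RightUnique r) {x y : α} (h : ReflTransGen r x y)
    (hy : ∀ z, ¬ r y z) : ¬ TransGen r x x := by
  induction h using ReflTransGen.head_induction_on with
  | refl =>
    intro h
    obtain ⟨z, hz, -⟩ := TransGen.head'_iff.1 h
    exact hy z hz
  | head hxz _ ih =>
    intro h
    obtain ⟨w, hw, hwx⟩ := TransGen.head'_iff.1 h
    cases hr hxz hw
    exact ih (TransGen.tail' hwx hw)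

end PartialInjection

/-! ### Part arcs and crossings -/

/-- `p` is one of the two positions involved in the crossing `k`. -/
def AtCrossing (β : BraidWord m) (k : Crossing β) (p : Fin (m + 1)) : Prop :=
  p = (gen β k).castSucc ∨ p = (gen β k).succ

theorem joined_rightUnique (β : BraidWord m) : Relator.RightUnique (Joined β) := by
  intro x y z h₁ h₂
  generalize hx : x = x' at h₂
  rcases h₁ with ⟨k, p, _, _⟩ | p <;> rcases h₂ with ⟨l, q, _, _⟩ | q
  · simp only [Prod.mk.injEq, Fin.castSucc_inj] at hx
    rw [hx.1, hx.2]
  · exact absurd (Prod.mk.inj hx).1 (Fin.castSucc_lt_last k).ne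
  · exact absurd (Prod.mk.inj hx).1.symm (Fin.castSucc_lt_last l).ne
  · rw [(Prod.mk.inj hx).2]

theorem joined_leftUnique (β : BraidWord m) : Relator.LeftUnique (Joined β) := by
  intro x y z h₁ h₂
  generalize hx : z = z' at h₂
  rcases h₁ with ⟨k, p, _, _⟩ | p <;> rcases h₂ with ⟨l, q, _, _⟩ | q
  · simp only [Prod.mk.injEq, Fin.succ_inj] at hx
    rw [hx.1, hx.2]
  · exact absurd (Prod.mk.inj hx).1 (Fin.succ_ne_zero k)
  · exact absurd (Prod.mk.inj hx).1.symm (Fin.succ_ne_zero l)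
  · rw [(Prod.mk.inj hx).2]

theorem joined_sink_iff {β : BraidWord m} {x : Point β} :
    (∀ y, ¬ Joined β x y) ↔ ∃ k p, AtCrossing β k p ∧ x = (k.castSucc, p) := by
  constructor
  · obtain ⟨l, p⟩ := x
    intro h
    induction l using Fin.lastCases with
    | last => exact absurd (Joined.closing p) (h _)
    | cast k =>
      refine ⟨k, p, ?_, rfl⟩
      by_contra hp
      rw [AtCrossing, not_or] at hp
      exact h _ (Joined.through k p hp.1 hp.2)
  · rintro ⟨k, p, hp, rfl⟩ y h
    generalize hx : ((k.castSucc, p) : Point β) = x' at h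
    rcases h with ⟨l, q, h₁, h₂⟩ | q
    · simp only [Prod.mk.injEq, Fin.castSucc_inj] at hx
      obtain ⟨rfl, rfl⟩ := hx
      exact hp.elim h₁ h₂
    · exact (Fin.castSucc_lt_last k).ne (Prod.mk.inj hx).1

theorem joined_source_iff {β : BraidWord m} {x : Point β} :
    (∀ y, ¬ Joined β y x) ↔ ∃ k p, AtCrossing β k p ∧ x = (k.succ, p) := by
  constructor
  · obtain ⟨l, p⟩ := x
    intro h
    induction l using Fin.cases with
    | zero => exact absurd (Joined.closing p) (h _)
    | succ k =>
      refine ⟨k, p, ?_, rfl⟩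
      by_contra hp
      rw [AtCrossing, not_or] at hp
      exact h _ (Joined.through k p hp.1 hp.2)
  · rintro ⟨k, p, hp, rfl⟩ y h
    generalize hx : ((k.succ, p) : Point β) = x' at h
    rcases h with ⟨l, q, h₁, h₂⟩ | q
    · simp only [Prod.mk.injEq, Fin.succ_inj] at hx
      obtain ⟨rfl, rfl⟩ := hx
      exact hp.elim h₁ h₂
    · exact (Fin.succ_ne_zero k) (Prod.mk.inj hx).1

theorem partArc_in_inj {β : BraidWord m} {k l : Crossing β} {p q : Fin (m + 1)}
    (hp : AtCrossing β k p) (hq : AtCrossing β l q)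
    (h : partArc β (k.castSucc, p) = partArc β (l.castSucc, q)) : k = l ∧ p = q := by
  have := eq_of_sinks (joined_rightUnique β) h (joined_sink_iff.2 ⟨k, p, hp, rfl⟩)
    (joined_sink_iff.2 ⟨l, q, hq, rfl⟩)
  simpa using this

theorem partArc_out_inj {β : BraidWord m} {k l : Crossing β} {p q : Fin (m + 1)}
    (hp : AtCrossing β k p) (hq : AtCrossing β l q)
    (h : partArc β (k.succ, p) = partArc β (l.succ, q)) : k = l ∧ p = q := by
  have := eq_of_sources (joined_leftUnique β) h (joined_source_iff.2 ⟨k, p, hp, rfl⟩)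
    (joined_source_iff.2 ⟨l, q, hq, rfl⟩)
  simpa using this

theorem atCrossing_left {β : BraidWord m} (k : Crossing β) (P : Prop) [Decidable P] :
    AtCrossing β k (if P then (gen β k).castSucc else (gen β k).succ) := by
  unfold AtCrossing; split_ifs <;> simp

theorem atCrossing_right {β : BraidWord m} (k : Crossing β) (P : Prop) [Decidable P] :
    AtCrossing β k (if P then (gen β k).succ else (gen β k).castSucc) := by
  unfold AtCrossing; split_ifs <;> simp

theorem overIn_injective (β : BraidWord m) : Function.Injective (overIn β) := fun k l h =>
  (partArc_in_inj (atCrossing_left k _) (atCrossing_left l _) h).1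

theorem underIn_injective (β : BraidWord m) : Function.Injective (underIn β) := fun k l h =>
  (partArc_in_inj (atCrossing_right k _) (atCrossing_right l _) h).1

theorem overOut_injective (β : BraidWord m) : Function.Injective (overOut β) := fun k l h =>
  (partArc_out_inj (atCrossing_right k _) (atCrossing_right l _) h).1

theorem underOut_injective (β : BraidWord m) : Function.Injective (underOut β) := fun k l h =>
  (partArc_out_inj (atCrossing_left k _) (atCrossing_left l _) h).1

theorem overIn_ne_underIn (β : BraidWord m) (k l : Crossing β) : overIn β k ≠ underIn β l := by
  intro h
  obtain ⟨rfl, h⟩ := partArc_in_inj (atCrossing_left k _) (atCrossing_right l _) h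
  split_ifs at h
  · exact (Fin.castSucc_lt_succ).ne h
  · exact (Fin.castSucc_lt_succ).ne h.symm

theorem overOut_ne_underOut (β : BraidWord m) (k l : Crossing β) :
    overOut β k ≠ underOut β l := by
  intro h
  obtain ⟨rfl, h⟩ := partArc_out_inj (atCrossing_right k _) (atCrossing_left l _) h
  split_ifs at h
  · exact (Fin.castSucc_lt_succ).ne h.symm
  · exact (Fin.castSucc_lt_succ).ne h

theorem exists_eq_in_of_atCrossing {β : BraidWord m} {k : Crossing β} {p : Fin (m + 1)}
    (h : AtCrossing β k p) : partArc β (k.castSucc, p) = overIn β k ∨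
      partArc β (k.castSucc, p) = underIn β k := by
  rcases h with rfl | rfl <;> by_cases hs : sgn β k = 1 <;> simp [overIn, underIn, hs]

theorem exists_eq_out_of_atCrossing {β : BraidWord m} {k : Crossing β} {p : Fin (m + 1)}
    (h : AtCrossing β k p) : partArc β (k.succ, p) = overOut β k ∨
      partArc β (k.succ, p) = underOut β k := by
  rcases h with rfl | rfl <;> by_cases hs : sgn β k = 1 <;> simp [overOut, underOut, hs]

theorem quot_mk_eq_of_reflTransGen {α : Type*} {r : α → α → Prop} {x y : α}
    (h : Relation.ReflTransGen r x y) : Quot.mk r x = Quot.mk r y := by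
  induction h with
  | refl => rfl
  | tail _ h ih => exact ih.trans (Quot.sound h)

/-- A part arc that leaves a crossing also enters one. -/
theorem exists_in_of_out {β : BraidWord m} {k : Crossing β} {p : Fin (m + 1)}
    (h : AtCrossing β k p) : ∃ l, partArc β (k.succ, p) = overIn β l ∨
      partArc β (k.succ, p) = underIn β l := by
  have hs := joined_source_iff.2 ⟨k, p, h, rfl⟩
  rcases exists_sink_or_cycle (joined_leftUnique β) (k.succ, p) with ⟨y, hy, hy'⟩ | hc
  · obtain ⟨l, q, hq, rfl⟩ := joined_sink_iff.1 hy'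
    refine ⟨l, ?_⟩
    have : partArc β (k.succ, p) = partArc β (l.castSucc, q) := quot_mk_eq_of_reflTransGen hy
    rw [this]
    exact exists_eq_in_of_atCrossing hq
  · obtain ⟨z, -, hz⟩ := Relation.TransGen.tail'_iff.1 hc
    exact absurd hz (hs z)

/-- A part arc that enters a crossing also leaves one. -/
theorem exists_out_of_in {β : BraidWord m} {k : Crossing β} {p : Fin (m + 1)}
    (h : AtCrossing β k p) : ∃ l, partArc β (k.castSucc, p) = overOut β l ∨
      partArc β (k.castSucc, p) = underOut β l := by
  have hs := joined_sink_iff.2 ⟨k, p, h, rfl⟩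
  rcases exists_source_or_cycle (joined_rightUnique β) (k.castSucc, p) with ⟨y, hy, hy'⟩ | hc
  · obtain ⟨l, q, hq, rfl⟩ := joined_source_iff.1 hy'
    refine ⟨l, ?_⟩
    have : partArc β (l.succ, q) = partArc β (k.castSucc, p) := quot_mk_eq_of_reflTransGen hy
    rw [← this]
    exact exists_eq_out_of_atCrossing hq
  · obtain ⟨z, hz, -⟩ := Relation.TransGen.head'_iff.1 hc
    exact absurd hz (hs z)

/-! ### Overcrossing arcs and circles -/

theorem overStep_iff {β : BraidWord m} {x y : PartArc β} :
    OverStep β x y ↔ ∃ k, x = overIn β k ∧ y = overOut β k := by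
  constructor
  · rintro ⟨k⟩; exact ⟨k, rfl, rfl⟩
  · rintro ⟨k, rfl, rfl⟩; exact .over k

theorem overStep_rightUnique (β : BraidWord m) : Relator.RightUnique (OverStep β) := by
  intro x y z h₁ h₂
  obtain ⟨k, rfl, rfl⟩ := overStep_iff.1 h₁
  obtain ⟨l, h, rfl⟩ := overStep_iff.1 h₂
  rw [overIn_injective β h]

theorem overStep_leftUnique (β : BraidWord m) : Relator.LeftUnique (OverStep β) := by
  intro x y z h₁ h₂
  obtain ⟨k, rfl, rfl⟩ := overStep_iff.1 h₁
  obtain ⟨l, rfl, h⟩ := overStep_iff.1 h₂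
  rw [overOut_injective β h]

theorem underIn_sink (β : BraidWord m) (k : Crossing β) (y : PartArc β) :
    ¬ OverStep β (underIn β k) y := by
  intro h
  obtain ⟨l, h, -⟩ := overStep_iff.1 h
  exact overIn_ne_underIn β l k h.symm

theorem underOut_source (β : BraidWord m) (k : Crossing β) (y : PartArc β) :
    ¬ OverStep β y (underOut β k) := by
  intro h
  obtain ⟨l, -, h⟩ := overStep_iff.1 h
  exact overOut_ne_underOut β l k h.symm

theorem arcEnding_injective (β : BraidWord m) : Function.Injective (arcEnding β) :=
  fun k l h => underIn_injective β
    (eq_of_sinks (overStep_rightUnique β) h (underIn_sink β k) (underIn_sink β l))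

theorem blueTarget_injective (β : BraidWord m) : Function.Injective (blueTarget β) :=
  fun k l h => underOut_injective β
    (eq_of_sources (overStep_leftUnique β) h (underOut_source β k) (underOut_source β l))

/-- A sink of the overcrossing steps that leaves a crossing is the end of an overcrossing arc. -/
theorem exists_underIn_of_sink {β : BraidWord m} {x y : PartArc β}
    (hx : (∃ k, x = overOut β k) ∨ ∃ k, x = underOut β k) (h : Precedes β x y)
    (hy : ∀ z, ¬ OverStep β y z) : ∃ k, y = underIn β k := by
  have hout : (∃ k, y = overOut β k) ∨ ∃ k, y = underOut β k := by
    rcases h.cases_tail with rfl | ⟨z, -, hz⟩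
    · exact hx
    · obtain ⟨k, -, rfl⟩ := overStep_iff.1 hz
      exact .inl ⟨k, rfl⟩
  have hin : ∃ l, y = overIn β l ∨ y = underIn β l := by
    rcases hout with ⟨k, rfl⟩ | ⟨k, rfl⟩
    · exact exists_in_of_out (atCrossing_right k _)
    · exact exists_in_of_out (atCrossing_left k _)
  obtain ⟨l, rfl | rfl⟩ := hin
  · exact absurd (.over l) (hy _)
  · exact ⟨l, rfl⟩

/-- A source of the overcrossing steps on an overcrossing arc is the beginning of the arc. -/
theorem exists_underOut_of_source {β : BraidWord m} {x : PartArc β} {k : Crossing β}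
    (h : overArc β x = arcEnding β k) (hx : ∀ z, ¬ OverStep β z x) :
    ∃ k, x = underOut β k := by
  have h' := reflTransGen_of_sink (overStep_rightUnique β) h (underIn_sink β k)
  have hout : ∃ l, x = overOut β l ∨ x = underOut β l := by
    rcases h'.cases_head with rfl | ⟨z, hz, -⟩
    · exact exists_out_of_in (atCrossing_right k _)
    · obtain ⟨l, rfl, -⟩ := overStep_iff.1 hz
      exact exists_out_of_in (atCrossing_left l _)
  obtain ⟨l, rfl | rfl⟩ := hout
  · exact absurd (.over l) (hx _)
  · exact ⟨l, rfl⟩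

/-- No overcrossing arc starts on an overcrossing circle. -/
theorem not_isOverCircle_blueTarget (β : BraidWord m) (k : Crossing β) :
    ¬ IsOverCircle β (blueTarget β k) := by
  intro hc
  rcases exists_sink_or_cycle (overStep_leftUnique β) (underOut β k) with ⟨y, hy, hy'⟩ | h
  · obtain ⟨l, rfl⟩ := exists_underIn_of_sink (.inr ⟨k, rfl⟩) hy hy'
    exact hc l (overArc_eq_of_precedes hy).symm
  · obtain ⟨z, -, hz⟩ := Relation.TransGen.tail'_iff.1 h
    exact underOut_source β k z hz

/-- Along an overcrossing circle one returns to the beginning of an overcrossing. -/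
theorem precedes_overOut_overIn_of_isOverCircle {β : BraidWord m} {k : Crossing β}
    (hc : IsOverCircle β (redTarget β k)) : Precedes β (overOut β k) (overIn β k) := by
  rcases exists_sink_or_cycle (overStep_leftUnique β) (overIn β k) with ⟨y, hy, hy'⟩ | h
  · have hy₂ : Precedes β (overOut β k) y := by
      rcases hy.cases_head with rfl | ⟨z, hz, hzy⟩
      · exact absurd (.over k) (hy' _)
      · rwa [overStep_rightUnique β hz (.over k)] at hzy
    obtain ⟨l, rfl⟩ := exists_underIn_of_sink (.inl ⟨k, rfl⟩) hy₂ hy'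
    exact absurd (overArc_eq_of_precedes hy).symm (hc l)
  · obtain ⟨z, hz, hzx⟩ := Relation.TransGen.head'_iff.1 h
    rwa [overStep_rightUnique β hz (.over k)] at hzx

theorem not_precedes_overOut_overIn {β : BraidWord m} {k : Crossing β}
    (hc : ¬ IsOverCircle β (redTarget β k)) : ¬ Precedes β (overOut β k) (overIn β k) := by
  simp only [IsOverCircle, not_forall, not_not] at hc
  obtain ⟨l, hl⟩ := hc
  intro h
  exact not_cycle_of_sink (overStep_rightUnique β)
    (reflTransGen_of_sink (overStep_rightUnique β) hl.symm (underIn_sink β l))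
    (underIn_sink β l) (Relation.TransGen.head' (.over k) h)

theorem precedes_overOut_iff {β : BraidWord m} {k : Crossing β} {x : PartArc β} :
    Precedes β x (overOut β k) ↔ x = overOut β k ∨ Precedes β x (overIn β k) := by
  constructor
  · intro h
    rcases h.cases_tail with h | ⟨z, hz, hs⟩
    · exact .inl h.symm
    · rw [overStep_leftUnique β hs (.over k)] at hz
      exact .inr hz
  · rintro (rfl | h)
    · exact .refl
    · exact h.tail (.over k)

/-! ### Flows on the arc graph and flows on the part arc-graph -/

theorem sum_blue_eq (β : BraidWord m) (f : ArcEdge β → ℕ) (k : Crossing β) :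
    open Classical in ∑ l with blueTarget β l = blueTarget β k, f (.blue l) = f (.blue k) := by
  classical
  rw [Finset.sum_filter, Finset.sum_eq_single k]
  · simp
  · intro l _ hl
    exact if_neg fun h => hl (blueTarget_injective β h)
  · simp

theorem sum_blue_eq_zero (β : BraidWord m) (f : ArcEdge β → ℕ) {w : OverArc β}
    (hw : IsOverCircle β w) :
    open Classical in ∑ l with blueTarget β l = w, f (.blue l) = 0 := by
  classical
  refine Finset.sum_eq_zero fun l hl => absurd hw ?_
  rw [← (Finset.mem_filter.1 hl).2]
  exact not_isOverCircle_blueTarget β l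

theorem redTarget_eq_of_precedes {β : BraidWord m} {k : Crossing β} {x : PartArc β}
    (h : Precedes β (overOut β k) x) : redTarget β k = overArc β x :=
  (Quot.sound (OverStep.over k)).trans (overArc_eq_of_precedes h)

theorem precedingSum_underOut (β : BraidWord m) (f : ArcEdge β → ℕ) (k : Crossing β) :
    precedingSum β f (underOut β k) = f (.blue k) := by
  classical
  have h₁ : ¬ IsOverCircle β (overArc β (underOut β k)) := not_isOverCircle_blueTarget β k
  have h₂ : ∀ l, ¬ Precedes β (overOut β l) (underOut β k) := fun l h =>
    overOut_ne_underOut β l k (eq_of_reflTransGen_of_source (underOut_source β k) h)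
  have h₃ := sum_blue_eq β f k
  unfold blueTarget at h₃
  simp only [precedingSum, dif_neg h₁, h₂, Finset.filter_false, Finset.sum_empty, add_zero]
  exact h₃

/-- Along an overcrossing the preceding sum picks up the color of the red edge, provided that
the red edges into circles are not colored. -/
theorem precedingSum_overOut (β : BraidWord m) (f : ArcEdge β → ℕ)
    (hf : ∀ k, IsOverCircle β (redTarget β k) → f (.red k) = 0) (k : Crossing β) :
    precedingSum β f (overOut β k) = precedingSum β f (overIn β k) + f (.red k) := by
  classical
  have hw : overArc β (overOut β k) = overArc β (overIn β k) := (Quot.sound (.over k)).symm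
  unfold precedingSum
  rw [hw, add_assoc _ _ (f (.red k))]
  congr 1
  by_cases hc : IsOverCircle β (redTarget β k)
  · have hz : ∀ x, overArc β x = redTarget β k →
        ∑ l with Precedes β (overOut β l) x, f (.red l) = 0 := by
      intro x hx
      refine Finset.sum_eq_zero fun l hl => hf l ?_
      rwa [redTarget_eq_of_precedes (Finset.mem_filter.1 hl).2, hx]
    rw [hz _ hw, hz _ rfl, hf k hc]
  · rw [add_comm _ (f (.red k)), ← Finset.sum_insert (f := fun l => f (.red l))]
    · refine Finset.sum_congr ?_ fun _ _ => rfl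
      ext l
      simp only [Finset.mem_filter, Finset.mem_univ, true_and, Finset.mem_insert,
        precedes_overOut_iff, (overOut_injective β).eq_iff]
    · simpa using not_precedes_overOut_overIn hc

theorem precedingSum_underIn (β : BraidWord m) (f : ArcEdge β → ℕ) (k : Crossing β) :
    precedingSum β f (underIn β k) = inFlow β f (arcEnding β k) := by
  classical
  have h₁ : ¬ IsOverCircle β (overArc β (underIn β k)) := fun h => h k rfl
  have h₂ : ∀ l, Precedes β (overOut β l) (underIn β k) ↔ redTarget β l = arcEnding β k := by
    intro l
    refine ⟨redTarget_eq_of_precedes, fun h => ?_⟩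
    refine reflTransGen_of_sink (overStep_rightUnique β) ?_ (underIn_sink β k)
    exact (Quot.sound (OverStep.over l)).symm.trans h
  simp only [precedingSum, dif_neg h₁, h₂, add_zero, inFlow, arcEnding]
  congr!

theorem outFlow_arcEnding (β : BraidWord m) (f : ArcEdge β → ℕ) (k : Crossing β) :
    outFlow β f (arcEnding β k) = f (.blue k) + f (.red k) := by
  classical
  unfold outFlow
  rw [Finset.sum_filter, Finset.sum_eq_single k]
  · simp
  · intro l _ hl
    exact if_neg fun h => hl (arcEnding_injective β h)
  · simp

theorem outFlow_eq_zero {β : BraidWord m} (f : ArcEdge β → ℕ) {w : OverArc β}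
    (hw : IsOverCircle β w) : outFlow β f w = 0 := by
  classical
  exact Finset.sum_eq_zero fun l hl => absurd (Finset.mem_filter.1 hl).2 (hw l)

/-- Nothing leaves a circle, so nothing flows into it. -/
theorem red_eq_zero_of_arcStates {n : ℕ} {β : BraidWord m} {f : ArcEdge β → ℕ}
    (hf : f ∈ arcStates n β) (k : Crossing β) (hk : IsOverCircle β (redTarget β k)) :
    f (.red k) = 0 := by
  classical
  have h := (hf.1 (redTarget β k)).1
  rw [outFlow_eq_zero f hk, inFlow, add_eq_zero, Finset.sum_eq_zero_iff (ι := Crossing β)] at h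
  exact Finset.sum_eq_zero_iff.1 h.2 k (by simp)

theorem precedingSum_of_isOverCircle {β : BraidWord m} {f : ArcEdge β → ℕ}
    (hf : ∀ k, IsOverCircle β (redTarget β k) → f (.red k) = 0) {x : PartArc β}
    (hx : IsOverCircle β (overArc β x)) :
    precedingSum β f x = f (.circle ⟨overArc β x, hx⟩) := by
  classical
  have h₁ := sum_blue_eq_zero β f hx
  have h₂ : ∑ l with Precedes β (overOut β l) x, f (.red l) = 0 := by
    refine Finset.sum_eq_zero fun l hl => hf l ?_
    rwa [redTarget_eq_of_precedes (Finset.mem_filter.1 hl).2]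
  simp only [precedingSum, dif_pos hx]
  rw [h₁, h₂, zero_add, add_zero]

theorem precedingSum_le {n : ℕ} {β : BraidWord m} {f : ArcEdge β → ℕ}
    (hf : f ∈ arcStates n β) (x : PartArc β) : precedingSum β f x ≤ n := by
  classical
  by_cases hx : IsOverCircle β (overArc β x)
  · rw [precedingSum_of_isOverCircle (red_eq_zero_of_arcStates hf) hx]
    exact hf.2.1 _
  · have h := hf.1 (overArc β x)
    refine le_trans ?_ (h.1.le.trans h.2)
    simp only [precedingSum, dif_neg hx, add_zero, inFlow]
    refine Nat.add_le_add_left (Finset.sum_le_sum_of_subset fun l hl => ?_) _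
    simp only [Finset.mem_filter, Finset.mem_univ, true_and] at hl ⊢
    exact redTarget_eq_of_precedes hl

theorem flowMap_overOut {n : ℕ} {β : BraidWord m} {f : ArcEdge β → ℕ}
    (hf : f ∈ arcStates n β) (k : Crossing β) :
    flowMap β f (overOut β k) = flowMap β f (overIn β k) + f (.red k) :=
  precedingSum_overOut β f (red_eq_zero_of_arcStates hf) k

theorem flowMap_mem_partStates {n : ℕ} {β : BraidWord m} {f : ArcEdge β → ℕ}
    (hf : f ∈ arcStates n β) : flowMap β f ∈ partStates .down n β := by
  refine ⟨precedingSum_le hf, fun k => ?_, fun k => ?_, hf.2.2⟩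
  · have h₁ : flowMap β f (underOut β k) = f (.blue k) := precedingSum_underOut β f k
    have h₂ : flowMap β f (underIn β k) = f (.blue k) + f (.red k) := by
      rw [flowMap, precedingSum_underIn, (hf.1 _).1, outFlow_arcEnding]
    simp only [overSrc, underSrc, overTgt, underTgt, flowMap_overOut hf k, h₁, h₂]
    ring
  · simp only [overSrc, overTgt, flowMap_overOut hf k]
    exact Nat.le_add_right _ _

theorem flowMap_injOn (n : ℕ) (β : BraidWord m) : Set.InjOn (flowMap β) (arcStates n β) := by
  intro f hf g hg h
  have hx : ∀ x, precedingSum β f x = precedingSum β g x := congrFun h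
  funext e
  rcases e with k | k | ⟨w, hw⟩
  · rw [← precedingSum_underOut β f, ← precedingSum_underOut β g, hx]
  · have h₁ := flowMap_overOut hf k
    have h₂ := flowMap_overOut hg k
    rw [h] at h₁
    omega
  · obtain ⟨x, rfl⟩ := Quot.exists_rep w
    have h₁ := precedingSum_of_isOverCircle (red_eq_zero_of_arcStates hf) hw
    have h₂ := precedingSum_of_isOverCircle (red_eq_zero_of_arcStates hg) hw
    exact h₁.symm.trans ((hx x).trans h₂)

/-- The coloring of the arc graph that belongs to a coloring of the part arcs: blue edges carry
the color with which the overcrossing arc starts, red edges the jump at the overcrossing. -/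
def flowInv (β : BraidWord m) (s : PartArc β → ℕ) : ArcEdge β → ℕ
  | .blue k => s (underOut β k)
  | .red k => s (overOut β k) - s (overIn β k)
  | .circle w => s w.1.out

theorem le_of_precedes {n : ℕ} {β : BraidWord m} {s : PartArc β → ℕ}
    (hs : s ∈ partStates .down n β) {x y : PartArc β} (h : Precedes β x y) : s x ≤ s y := by
  induction h with
  | refl => exact le_rfl
  | tail _ h ih =>
    obtain ⟨k, rfl, rfl⟩ := overStep_iff.1 h
    exact ih.trans (hs.2.2.1 k)

theorem eq_of_isOverCircle_redTarget {n : ℕ} {β : BraidWord m} {s : PartArc β → ℕ}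
    (hs : s ∈ partStates .down n β) {k : Crossing β} (hk : IsOverCircle β (redTarget β k)) :
    s (overOut β k) = s (overIn β k) :=
  le_antisymm (le_of_precedes hs (precedes_overOut_overIn_of_isOverCircle hk)) (hs.2.2.1 k)

/-- A state is constant along overcrossing circles. -/
theorem eq_of_precedes_of_isOverCircle {n : ℕ} {β : BraidWord m} {s : PartArc β → ℕ}
    (hs : s ∈ partStates .down n β) {x y : PartArc β} (hx : IsOverCircle β (overArc β x))
    (h : Precedes β x y) : s x = s y := by
  induction h with
  | refl => rfl
  | tail h' h ih =>
    rw [ih]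
    rw [overArc_eq_of_precedes h'] at hx
    obtain ⟨k, rfl, rfl⟩ := overStep_iff.1 h
    exact (eq_of_isOverCircle_redTarget hs hx).symm

/-- On a circle this is constancy; on an overcrossing arc it follows by induction from the start
of the arc. -/
theorem precedingSum_flowInv {n : ℕ} {β : BraidWord m} {s : PartArc β → ℕ}
    (hs : s ∈ partStates .down n β) (x : PartArc β) :
    precedingSum β (flowInv β s) x = s x := by
  have hr : ∀ k, IsOverCircle β (redTarget β k) → flowInv β s (.red k) = 0 := fun k hk => by
    simp [flowInv, eq_of_isOverCircle_redTarget hs hk]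
  by_cases hx : IsOverCircle β (overArc β x)
  · rw [precedingSum_of_isOverCircle hr hx]
    obtain ⟨z, h₁, h₂⟩ := exists_common_target (overStep_rightUnique β)
      (Quot.out_eq (overArc β x) : Quot.mk _ (overArc β x).out = Quot.mk _ x)
    have hy : IsOverCircle β (overArc β (overArc β x).out) := by
      rw [overArc_eq_of_precedes h₁, ← overArc_eq_of_precedes h₂]; exact hx
    exact (eq_of_precedes_of_isOverCircle hs hy h₁).trans
      (eq_of_precedes_of_isOverCircle hs hx h₂).symm
  · have hx' := hx
    simp only [IsOverCircle, not_forall, not_not] at hx'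
    obtain ⟨l, hl⟩ := hx'
    rcases exists_source_or_cycle (overStep_rightUnique β) x with ⟨y, hy, hy'⟩ | h
    · obtain ⟨k, rfl⟩ :=
        exists_underOut_of_source ((overArc_eq_of_precedes hy).trans hl.symm) hy'
      clear hx hl
      induction hy with
      | refl => exact precedingSum_underOut β _ k
      | tail _ h ih =>
        obtain ⟨k, rfl, rfl⟩ := overStep_iff.1 h
        rw [precedingSum_overOut β _ hr, ih]
        exact Nat.add_sub_cancel' (hs.2.2.1 k)
    · exact absurd h (not_cycle_of_sink (overStep_rightUnique β)
        (reflTransGen_of_sink (overStep_rightUnique β) hl.symm (underIn_sink β l))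
        (underIn_sink β l))

theorem flowInv_mem_arcStates {n : ℕ} {β : BraidWord m} {s : PartArc β → ℕ}
    (hs : s ∈ partStates .down n β) : flowInv β s ∈ arcStates n β := by
  classical
  have hr : ∀ k, IsOverCircle β (redTarget β k) → flowInv β s (.red k) = 0 := fun k hk => by
    simp [flowInv, eq_of_isOverCircle_redTarget hs hk]
  refine ⟨fun w => ?_, fun w => hs.1 _, ?_⟩
  · by_cases hw : IsOverCircle β w
    · rw [outFlow_eq_zero _ hw]
      refine ⟨?_, Nat.zero_le _⟩
      rw [inFlow, sum_blue_eq_zero β _ hw, zero_add]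
      refine Finset.sum_eq_zero fun l hl => hr l ?_
      rwa [(Finset.mem_filter.1 hl).2]
    · simp only [IsOverCircle, not_forall, not_not] at hw
      obtain ⟨k, rfl⟩ := hw
      have h₁ := hs.2.1 k
      have h₂ := hs.2.2.1 k
      have h₃ := hs.1 (underIn β k)
      simp only [overSrc, underSrc, overTgt, underTgt] at h₁ h₂
      rw [← precedingSum_underIn, precedingSum_flowInv hs, outFlow_arcEnding]
      simp only [flowInv]
      omega
  · rw [precedingSum_flowInv hs]
    exact hs.2.2.2

theorem flowMap_bijOn (n : ℕ) (β : BraidWord m) :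
    Set.BijOn (flowMap β) (arcStates n β) (partStates .down n β) :=
  ⟨fun _ hf => flowMap_mem_partStates hf, flowMap_injOn n β, fun s hs =>
    ⟨flowInv β s, flowInv_mem_arcStates hs, funext (precedingSum_flowInv hs)⟩⟩

/-! ### Quantum integers -/

theorem tRoot_ne_zero : tRoot ≠ 0 := RatFunc.X_ne_zero

theorem vv_ne_zero : vv ≠ 0 := pow_ne_zero _ tRoot_ne_zero

theorem vv_zpow (a : ℤ) : vv ^ a = tRoot ^ (2 * a) := by
  rw [vv, zpow_mul]; rfl

theorem tt_zpow (a : ℤ) : tt ^ a = tRoot ^ (4 * a) := by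
  rw [tt, zpow_mul]; rfl

theorem tRoot_zpow_ne_one {a : ℤ} (ha : a ≠ 0) : tRoot ^ a ≠ 1 := by
  have key : ∀ k : ℕ, k ≠ 0 → tRoot ^ k ≠ 1 := by
    intro k hk h
    rw [tRoot, ← RatFunc.algebraMap_X, ← map_pow, ← map_one (algebraMap (Polynomial ℚ) 𝕂)] at h
    have h' := congrArg Polynomial.natDegree (RatFunc.algebraMap_injective ℚ h)
    rw [Polynomial.natDegree_X_pow, Polynomial.natDegree_one] at h'
    exact hk h'
  obtain ⟨k, rfl | rfl⟩ := a.eq_nat_or_neg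
  · rw [zpow_natCast]
    exact key k (by simpa using ha)
  · rw [zpow_neg, zpow_natCast, ne_eq, inv_eq_one]
    exact key k (by simpa using ha)

theorem qBracket_ne_zero {a : ℤ} (ha : a ≠ 0) : qBracket a ≠ 0 := by
  intro h
  rw [qBracket, sub_eq_zero, vv_zpow, vv_zpow] at h
  have h' : tRoot ^ (4 * a) = 1 := by
    have : (4 * a : ℤ) = 2 * a - 2 * (-a) := by ring
    rw [this, zpow_sub₀ tRoot_ne_zero, h, div_self (zpow_ne_zero _ tRoot_ne_zero)]
  exact tRoot_zpow_ne_one (by omega) h'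

theorem qInt_ne_zero {a : ℤ} (ha : a ≠ 0) : qInt a ≠ 0 :=
  div_ne_zero (qBracket_ne_zero ha) (qBracket_ne_zero one_ne_zero)

theorem qPochhammer_succ (a : ℤ) (b : ℕ) :
    qPochhammer a (b + 1) = qPochhammer a b * qBracket (a - b) := Finset.prod_range_succ _ _

theorem qPochhammer_succ' (a : ℤ) (b : ℕ) :
    qPochhammer a (b + 1) = qBracket a * qPochhammer (a - 1) b := by
  rw [qPochhammer, Finset.prod_range_succ', mul_comm]
  congr 1
  · simp
  · refine Finset.prod_congr rfl fun s _ => ?_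
    congr 1
    push_cast
    ring

theorem qPochhammer_self_succ (k : ℕ) :
    qPochhammer (k + 1 : ℕ) (k + 1) = qBracket (k + 1) * qPochhammer k k := by
  rw [qPochhammer_succ']
  simp

theorem qPochhammer_self_ne_zero (k : ℕ) : qPochhammer k k ≠ 0 := by
  induction k with
  | zero => simp [qPochhammer]
  | succ k ih =>
    rw [qPochhammer_self_succ]
    exact mul_ne_zero (qBracket_ne_zero (by omega)) ih

theorem qPochhammer_add_mul (b r : ℕ) :
    qPochhammer (b + r) r * qPochhammer b b = qPochhammer (b + r : ℕ) (b + r) := by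
  induction r with
  | zero => simp [qPochhammer]
  | succ r ih =>
    rw [← add_assoc, qPochhammer_self_succ, ← ih, qPochhammer_succ']
    push_cast
    ring_nf

theorem qBinomial_eq (b r : ℕ) :
    qBinomial (b + r) r =
      qPochhammer (b + r : ℕ) (b + r) / (qPochhammer b b * qPochhammer r r) := by
  have := qPochhammer_self_ne_zero b
  have := qPochhammer_self_ne_zero r
  rw [← qPochhammer_add_mul, qBinomial]
  field_simp

/-- Both ways of extracting a monomial from `{a}`, according to the sign `ε`. -/
theorem qBracket_eq_signed (ε : ℤˣ) (a : ℤ) :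
    qBracket a = -(ε : 𝕂) * tRoot ^ (-(ε : ℤ) * (2 * a)) * (1 - (tt ^ (ε : ℤ)) ^ a) := by
  have h₁ : ((tRoot ^ (2 * a)) : 𝕂) ≠ 0 := zpow_ne_zero _ tRoot_ne_zero
  have h₂ : tRoot ^ (4 * a) = tRoot ^ (2 * a) * tRoot ^ (2 * a) := by
    rw [← zpow_add₀ tRoot_ne_zero]; ring_nf
  have h₃ : (tt ^ (-1 : ℤ)) ^ a = (tRoot ^ (2 * a) * tRoot ^ (2 * a))⁻¹ := by
    rw [← zpow_mul, neg_one_mul, zpow_neg, tt_zpow, h₂]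
  rcases Int.units_eq_one_or ε with rfl | rfl
  · simp only [Units.val_one, zpow_one, qBracket, vv_zpow, tt_zpow, h₂, neg_mul, one_mul,
      zpow_neg, Int.cast_one]
    field_simp
    ring
  · rw [Units.val_neg, Units.val_one, h₃]
    simp only [qBracket, vv_zpow, one_mul, zpow_neg, neg_neg, Int.cast_one, Int.cast_neg]
    field_simp

theorem qPochhammer_eq_signed (ε : ℤˣ) (a : ℤ) (r : ℕ) :
    qPochhammer a r = (-(ε : 𝕂)) ^ r * tRoot ^ (-(ε : ℤ) * (2 * r * a - r * (r - 1))) *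
      signedPochhammer (tt ^ (ε : ℤ)) a r := by
  induction r with
  | zero => simp [qPochhammer, signedPochhammer]
  | succ r ih =>
    have h : (-(ε : ℤ) * (2 * (r + 1 : ℕ) * a - (r + 1 : ℕ) * ((r + 1 : ℕ) - 1)) : ℤ) =
        -(ε : ℤ) * (2 * r * a - r * (r - 1)) + -(ε : ℤ) * (2 * (a - r)) := by
      push_cast; ring
    rw [qPochhammer_succ, ih, qBracket_eq_signed ε (a - r), h, zpow_add₀ tRoot_ne_zero,
      signedPochhammer, signedPochhammer, Finset.prod_range_succ]
    ring

theorem signedFactorial_succ (u : 𝕂) (a : ℕ) :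
    signedFactorial u (a + 1) = signedFactorial u a * ((u ^ (a + 1) - 1) / (u - 1)) :=
  Finset.prod_range_succ _ _

theorem qPochhammer_self_eq_signed (ε : ℤˣ) (k : ℕ) :
    qPochhammer k k = qBracket 1 ^ k * tRoot ^ ((ε : ℤ) * (k * (k - 1))) *
      signedFactorial (tt ^ (-(ε : ℤ))) k := by
  induction k with
  | zero => simp [qPochhammer, signedFactorial]
  | succ k ih =>
    have h₁ := qBracket_eq_signed (-ε) 1
    have h₂ := qBracket_eq_signed (-ε) (k + 1)
    simp only [Units.val_neg] at h₁ h₂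
    have h₃ : tt ^ (-(ε : ℤ)) - 1 ≠ 0 := by
      rw [tt_zpow]
      exact sub_ne_zero.2 (tRoot_zpow_ne_one (by simp))
    have h₄ : ((ε : ℤ) * ((k + 1 : ℕ) * ((k + 1 : ℕ) - 1)) : ℤ) + (ε : ℤ) * (2 * 1) =
        (ε : ℤ) * (k * (k - 1)) + (ε : ℤ) * (2 * (k + 1)) := by
      push_cast; ring
    have h₅ : (tRoot ^ ((ε : ℤ) * ((k + 1 : ℕ) * ((k + 1 : ℕ) - 1))) : 𝕂) *
        tRoot ^ ((ε : ℤ) * (2 * 1)) =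
        tRoot ^ ((ε : ℤ) * (k * (k - 1))) * tRoot ^ ((ε : ℤ) * (2 * (k + 1))) := by
      rw [← zpow_add₀ tRoot_ne_zero, ← zpow_add₀ tRoot_ne_zero, h₄]
    have h₆ : (tt ^ (-(ε : ℤ))) ^ ((k : ℤ) + 1) = (tt ^ (-(ε : ℤ))) ^ (k + 1) := by
      exact_mod_cast rfl
    rw [h₆] at h₂
    rw [qPochhammer_self_succ, ih, h₂, signedFactorial_succ, pow_succ (qBracket 1)]
    nth_rw 3 [h₁]
    simp only [neg_neg, zpow_one]
    field_simp
    linear_combination -(qBracket 1 ^ k * signedFactorial (tt ^ (-(ε : ℤ))) k *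
      ((tt ^ (-(ε : ℤ))) ^ (k + 1) - 1) * (tt ^ (-(ε : ℤ)) - 1)) * h₅

theorem signedFactorial_ne_zero {u : 𝕂} (hu : ∀ k : ℕ, u ^ (k + 1) ≠ 1) (a : ℕ) :
    signedFactorial u a ≠ 0 :=
  Finset.prod_ne_zero_iff.2 fun s _ => div_ne_zero (sub_ne_zero.2 (hu s))
    (sub_ne_zero.2 (by simpa using hu 0))

theorem tt_zpow_pow_ne_one (ε : ℤˣ) (k : ℕ) : (tt ^ (ε : ℤ)) ^ (k + 1) ≠ 1 := by
  rw [← zpow_natCast, ← zpow_mul, tt_zpow]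
  exact tRoot_zpow_ne_one (mul_ne_zero (by norm_num) (mul_ne_zero (by simp) (by omega)))

theorem qBinomial_eq_signed (ε : ℤˣ) (b r : ℕ) :
    qBinomial (b + r) r =
      tRoot ^ ((ε : ℤ) * (2 * b * r)) * signedBinomial (tt ^ (-(ε : ℤ))) (b + r) b := by
  have hε : ∀ k : ℕ, (tt ^ (-(ε : ℤ))) ^ (k + 1) ≠ 1 := tt_zpow_pow_ne_one (-ε)
  have h₁ := signedFactorial_ne_zero hε b
  have h₂ := signedFactorial_ne_zero hε r
  have h₃ := qBracket_ne_zero one_ne_zero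
  have h₄ : (tRoot ^ ((ε : ℤ) * ((b + r : ℕ) * ((b + r : ℕ) - 1))) : 𝕂) =
      tRoot ^ ((ε : ℤ) * (2 * b * r)) * (tRoot ^ ((ε : ℤ) * (b * (b - 1))) *
        tRoot ^ ((ε : ℤ) * (r * (r - 1)))) := by
    rw [← zpow_add₀ tRoot_ne_zero, ← zpow_add₀ tRoot_ne_zero]
    congr 1
    push_cast
    ring
  have h₅ : (tRoot ^ ((ε : ℤ) * (b * (b - 1))) : 𝕂) ≠ 0 := zpow_ne_zero _ tRoot_ne_zero
  have h₆ : (tRoot ^ ((ε : ℤ) * (r * (r - 1))) : 𝕂) ≠ 0 := zpow_ne_zero _ tRoot_ne_zero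
  rw [qBinomial_eq, qPochhammer_self_eq_signed ε, qPochhammer_self_eq_signed ε b,
    qPochhammer_self_eq_signed ε r, signedBinomial, h₄, Nat.add_sub_cancel_left, pow_add]
  field_simp

/-- Gaussian binomials are polynomials, by the `q`-Pascal rule. -/
theorem signedBinomial_mem (S : Subring 𝕂) {u : 𝕂} (hu : ∀ k : ℕ, u ^ (k + 1) ≠ 1)
    (hS : u ∈ S) (a b : ℕ) : signedBinomial u (b + a) b ∈ S := by
  have hne := signedFactorial_ne_zero hu
  have hu₁ : u - 1 ≠ 0 := sub_ne_zero.2 (by simpa using hu 0)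
  have h0 : signedFactorial u 0 = 1 := Finset.prod_range_zero _
  induction b generalizing a with
  | zero =>
    rw [signedBinomial, zero_add, Nat.sub_zero, h0, one_mul, div_self (hne a)]
    exact S.one_mem
  | succ b ihb =>
    induction a with
    | zero =>
      rw [signedBinomial, add_zero, Nat.sub_self, h0, mul_one, div_self (hne (b + 1))]
      exact S.one_mem
    | succ a iha =>
      have key : signedBinomial u (b + 1 + (a + 1)) (b + 1) =
          signedBinomial u (b + (a + 1)) b +
            u ^ (b + 1) * signedBinomial u (b + 1 + a) (b + 1) := by
        have e₁ : b + 1 + (a + 1) = b + (a + 1) + 1 := by ring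
        have e₂ : b + 1 + a = b + (a + 1) := by ring
        have h₁ : u ^ (b + 1) - 1 ≠ 0 := sub_ne_zero.2 (hu b)
        have h₂ : u ^ (a + 1) - 1 ≠ 0 := sub_ne_zero.2 (hu a)
        have h₃ := hne a
        have h₄ := hne b
        have s₁ : b + (a + 1) + 1 - (b + 1) = a + 1 := by omega
        have s₂ : b + (a + 1) - b = a + 1 := by omega
        have s₃ : b + (a + 1) - (b + 1) = a := by omega
        have h₅ : u ^ (b + (a + 1) + 1) = u ^ (b + 1) * u ^ (a + 1) := by
          rw [← pow_add]; ring_nf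
        simp only [signedBinomial, e₁, e₂, s₁, s₂, s₃]
        rw [signedFactorial_succ u (b + (a + 1)), signedFactorial_succ u a,
          signedFactorial_succ u b, h₅]
        field_simp
        ring
      rw [key]
      exact S.add_mem (ihb _) (S.mul_mem (S.pow_mem hS _) iha)

theorem tRoot_zpow_mem (a : ℤ) : tRoot ^ a ∈ laurentRing := by
  have h₁ : tRoot ∈ laurentRing := Subring.subset_closure (by simp)
  have h₂ : tRoot⁻¹ ∈ laurentRing := Subring.subset_closure (by simp)
  obtain ⟨k, rfl | rfl⟩ := a.eq_nat_or_neg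
  · rw [zpow_natCast]
    exact pow_mem h₁ k
  · rw [zpow_neg, zpow_natCast, ← inv_pow]
    exact pow_mem h₂ k

theorem tt_zpow_mem (a : ℤ) : tt ^ a ∈ laurentRing := by
  rw [tt_zpow]
  exact tRoot_zpow_mem _

theorem arcModel_contribution_mem (n : ℕ) (β : BraidWord m) (f : ArcEdge β → ℕ) :
    (arcModel n).contribution ⟨m, β⟩ f ∈ laurentRing := by
  rw [arcModel_contribution]
  refine mul_mem (tRoot_zpow_mem _) (mul_mem (tt_zpow_mem _) (prod_mem fun k _ => ?_))
  refine mul_mem (mul_mem (tt_zpow_mem _) ?_) (prod_mem fun s _ => sub_mem (one_mem _) ?_)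
  · exact signedBinomial_mem _ (tt_zpow_pow_ne_one (-sgn β k)) (tt_zpow_mem _) _ _
  · rw [← zpow_mul]
    exact tt_zpow_mem _

/-! ### Telescoping around the closed braid -/

/-- A product over the crossings of the changes of a local quantity telescopes around the
closed braid. -/
@[to_additive]
theorem prod_crossings_eq_one {G : Type*} [CommGroup G] (β : BraidWord m)
    (φ : Fin (m + 1) → PartArc β → G) :
    ∏ k, (φ (gen β k).castSucc (partArc β (k.succ, (gen β k).castSucc)) *
        φ (gen β k).succ (partArc β (k.succ, (gen β k).succ)) /
      (φ (gen β k).castSucc (partArc β (k.castSucc, (gen β k).castSucc)) *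
        φ (gen β k).succ (partArc β (k.castSucc, (gen β k).succ)))) = 1 := by
  have h₁ : ∀ k : Crossing β,
      (φ (gen β k).castSucc (partArc β (k.succ, (gen β k).castSucc)) *
        φ (gen β k).succ (partArc β (k.succ, (gen β k).succ)) /
      (φ (gen β k).castSucc (partArc β (k.castSucc, (gen β k).castSucc)) *
        φ (gen β k).succ (partArc β (k.castSucc, (gen β k).succ)))) =
      (∏ p, φ p (partArc β (k.succ, p))) / ∏ p, φ p (partArc β (k.castSucc, p)) := by
    intro k
    rw [← Finset.prod_div_distrib, Fintype.prod_eq_mul (gen β k).castSucc (gen β k).succ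
      (Fin.castSucc_lt_succ).ne, div_mul_div_comm]
    rintro p ⟨hp₁, hp₂⟩
    rw [div_eq_one]
    exact congrArg _ (Quot.sound (Joined.through k p hp₁ hp₂)).symm
  have h₂ : ∀ p, partArc β (Fin.last _, p) = partArc β (0, p) := fun p =>
    Quot.sound (Joined.closing p)
  have h₃ : (∏ p, φ p (partArc β (0, p))) * ∏ k : Crossing β, ∏ p, φ p (partArc β (k.succ, p)) =
      (∏ k : Crossing β, ∏ p, φ p (partArc β (k.castSucc, p))) * ∏ p, φ p (partArc β (0, p)) := by
    rw [← Fin.prod_univ_succ (fun l : Fin (β.length + 1) => ∏ p, φ p (partArc β (l, p))),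
      Fin.prod_univ_castSucc]
    simp only [h₂]
  rw [Finset.prod_congr rfl fun k _ => h₁ k, Finset.prod_div_distrib, div_eq_one]
  rw [mul_comm] at h₃
  exact mul_right_cancel h₃

/-! ### Equality of contributions -/

/-- The factors of a crossing in the two state models differ by a power of `t^{1/4}` whose
exponent telescopes. -/
theorem crossingFactor_flowMap {n : ℕ} {β : BraidWord m} {f : ArcEdge β → ℕ}
    (hf : f ∈ arcStates n β) (k : Crossing β) :
    crossingFactor .down n β k (flowMap β f) =
      tRoot ^ (-((n : ℤ) ^ 2 * sgn β k)) *
        (tt ^ (-((sgn β k : ℤ) * f (.blue k) * beforeRed β f k)) * vertexFactor n β f k) *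
        tRoot ^ (2 * (f (.red k) + n * (sgn β k : ℤ)) *
          (beforeRed β f k - (f (.blue k) : ℤ))) := by
  have h₁ : flowMap β f (overOut β k) = beforeRed β f k + f (.red k) := flowMap_overOut hf k
  have h₂ : flowMap β f (overIn β k) = beforeRed β f k := rfl
  have h₃ : flowMap β f (underOut β k) = f (.blue k) := precedingSum_underOut β f k
  simp only [crossingFactor, overSrc, underSrc, overTgt, h₁, h₂, h₃, Nat.add_sub_cancel_left,
    vertexFactor]
  generalize beforeRed β f k = a
  generalize f (.blue k) = b
  generalize f (.red k) = r
  have ha : ((n : ℤ) + r - (a + r : ℕ)) = n - a := by push_cast; ring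
  rcases Int.units_eq_one_or (sgn β k) with h | h
  · rw [if_pos h, fPlus, ha, qBinomial_eq_signed 1, qPochhammer_eq_signed 1, h]
    simp only [Units.val_one, mul_one, one_mul, tt_zpow]
    generalize signedBinomial _ _ _ = B
    generalize signedPochhammer _ _ _ = P
    have h₄ : (-1 : 𝕂) ^ r * (-1) ^ r = 1 := by rw [← mul_pow]; simp
    have h₅ : tRoot ^ (-(((n : ℤ) - 2 * (a + r : ℕ)) * (n - 2 * b) + r * (r - 1))) *
        tRoot ^ (2 * (b : ℤ) * r) * tRoot ^ (-1 * (2 * (r : ℤ) * (n - a) - r * (r - 1))) =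
        tRoot ^ (-(n : ℤ) ^ 2) * tRoot ^ (4 * (-((b : ℤ) * a))) * tRoot ^ (4 * ((n : ℤ) * b)) *
        tRoot ^ (2 * ((r : ℤ) + n) * (a - b)) := by
      simp only [← zpow_add₀ tRoot_ne_zero]
      congr 1
      push_cast
      ring
    simp only [Int.cast_one]
    linear_combination
      (tRoot ^ (-(((n : ℤ) - 2 * (a + r : ℕ)) * (n - 2 * b) + r * (r - 1))) *
        tRoot ^ (2 * (b : ℤ) * r) * tRoot ^ (-1 * (2 * (r : ℤ) * (n - a) - r * (r - 1)))) *
        B * P * h₄ + B * P * h₅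
  · rw [if_neg (by rw [h]; decide), fMinus, ha, qBinomial_eq_signed (-1),
      qPochhammer_eq_signed (-1), h]
    simp only [Units.val_neg, Units.val_one, tt_zpow]
    generalize signedBinomial _ _ _ = B
    generalize signedPochhammer _ _ _ = P
    have h₅ : tRoot ^ (((n : ℤ) - 2 * b - 2 * r) * (n - 2 * (a + r : ℕ) + 2 * r) + r * (r - 1)) *
        tRoot ^ (-1 * (2 * (b : ℤ) * r)) *
        tRoot ^ (-(-1) * (2 * (r : ℤ) * (n - a) - r * (r - 1))) =
        tRoot ^ (-((n : ℤ) ^ 2 * -1)) * tRoot ^ (4 * (-(-1 * (b : ℤ) * a))) *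
        tRoot ^ (4 * ((n : ℤ) * -1 * b)) * tRoot ^ (2 * ((r : ℤ) + n * -1) * (a - b)) := by
      simp only [← zpow_add₀ tRoot_ne_zero]
      congr 1
      push_cast
      ring
    simp only [Int.cast_neg, Int.cast_one, neg_neg, one_pow, one_mul] at h₅ ⊢
    linear_combination B * P * h₅

/-- The exponents by which the crossing factors differ are the changes of
`∑_p (2 n p c_p + c_p²)`, where `c_p` is the color at position `p`. -/
theorem sum_exponent_eq_zero {n : ℕ} {β : BraidWord m} {f : ArcEdge β → ℕ}
    (hf : f ∈ arcStates n β) :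
    ∑ k, 2 * (f (.red k) + n * (sgn β k : ℤ)) * (beforeRed β f k - (f (.blue k) : ℤ)) = 0 := by
  have h := sum_crossings_eq_zero β (fun p x =>
    2 * (n : ℤ) * (p : ℕ) * flowMap β f x + (flowMap β f x : ℤ) ^ 2)
  rw [← h]
  refine Finset.sum_congr rfl fun k _ => ?_
  have h₁ : flowMap β f (overOut β k) = beforeRed β f k + f (.red k) := flowMap_overOut hf k
  have h₂ : flowMap β f (overIn β k) = beforeRed β f k := rfl
  have h₃ : flowMap β f (underOut β k) = f (.blue k) := precedingSum_underOut β f k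
  have h₄ : flowMap β f (underIn β k) = f (.blue k) + f (.red k) := by
    rw [flowMap, precedingSum_underIn, (hf.1 _).1, outFlow_arcEnding]
  unfold overOut at h₁
  unfold overIn at h₂
  unfold underOut at h₃
  unfold underIn at h₄
  rcases Int.units_eq_one_or (sgn β k) with h | h
  · simp only [h, if_true] at h₁ h₂ h₃ h₄
    rw [h₁, h₂, h₃, h₄, h]
    simp only [Fin.val_castSucc, Fin.val_succ, Units.val_one]
    push_cast
    ring
  · have h' : ¬ ((-1 : ℤˣ) = 1) := by decide
    simp only [h, h', if_false] at h₁ h₂ h₃ h₄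
    rw [h₁, h₂, h₃, h₄, h]
    simp only [Fin.val_castSucc, Fin.val_succ, Units.val_neg, Units.val_one]
    push_cast
    ring

theorem tRoot_zpow_sum {ι : Type} (s : Finset ι) (a : ι → ℤ) :
    tRoot ^ (∑ i ∈ s, a i) = ∏ i ∈ s, tRoot ^ a i := by
  classical
  induction s using Finset.induction_on with
  | empty => simp
  | insert i s hi ih =>
    rw [Finset.sum_insert hi, Finset.prod_insert hi, zpow_add₀ tRoot_ne_zero, ih]

theorem rMatrixModel_contribution (o : Orient) (n : ℕ) (β : BraidWord m) (s : PartArc β → ℕ) :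
    (rMatrixModel o n).contribution ⟨m, β⟩ s =
      (∏ k, crossingFactor o n β k s) *
        ∏ p : Fin m, vv ^ extremumExp o n (s (closureArc β p.succ)) := by
  have hc : (rMatrixModel o n).contribution ⟨m, β⟩ s =
      1 * ∏ x : Crossing β ⊕ Fin m, (rMatrixModel o n).siteFactor ⟨m, β⟩ x s := rfl
  rw [hc, one_mul, Fintype.prod_sum_type]
  rfl

theorem contribution_flowMap {n : ℕ} {β : BraidWord m} {f : ArcEdge β → ℕ}
    (hf : f ∈ arcStates n β) :
    (rMatrixModel .down n).contribution ⟨m, β⟩ (flowMap β f) =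
      (arcModel n).contribution ⟨m, β⟩ f := by
  rw [rMatrixModel_contribution, arcModel_contribution,
    Finset.prod_congr rfl fun k _ => crossingFactor_flowMap hf k]
  simp only [Finset.prod_mul_distrib, ← tRoot_zpow_sum, sum_exponent_eq_zero hf,
    extremumExp, vv_zpow, tt_zpow, zpow_zero, mul_one, Finset.sum_neg_distrib, ← Finset.mul_sum]
  have h : (tRoot ^ (-((n : ℤ) ^ 2 * ∑ k, (sgn β k : ℤ))) : 𝕂) *
      tRoot ^ (4 * -∑ k, (sgn β k : ℤ) * f (.blue k) * beforeRed β f k) *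
      tRoot ^ (2 * ∑ p : Fin m, ((n : ℤ) - 2 * flowMap β f (closureArc β p.succ))) =
      tRoot ^ fourDeltaPrime n β * tRoot ^ (4 * delta β f) := by
    simp only [← zpow_add₀ tRoot_ne_zero]
    congr 1
    simp only [fourDeltaPrime, delta, exc, rot, writhe, flowMap, Finset.sum_sub_distrib,
      ← Finset.mul_sum, Finset.sum_const, Finset.card_univ, Fintype.card_fin, nsmul_eq_mul]
    ring
  linear_combination (∏ k, vertexFactor n β f k) * h

/-- The arc model is equivalent to the `R`-matrix model of the downwards oriented braid. -/
theorem arcModel_equivalentOver (n : ℕ) :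
    StateModel.EquivalentOver (arcModel n) (rMatrixModel .down n) id
      (fun K => flowMap K.2) := by
  have hb : ∀ K : Projection, Set.BijOn (flowMap K.2) (arcStates n K.2)
      (partStates .down n K.2) := fun K => flowMap_bijOn n K.2
  refine ⟨fun K => ⟨(hb K).mapsTo, (hb K).surjOn, fun s hs => ?_⟩, hb⟩
  obtain ⟨f, hf, rfl⟩ := (hb K).surjOn hs
  have hc : (rMatrixModel .down n).contribution K (flowMap K.2 f) =
      (arcModel n).contribution K f := contribution_flowMap hf
  refine hc.trans ?_
  by_cases h0 : (arcModel n).localFactor K f = 0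
  · have hz : (arcModel n).contribution K f = 0 :=
      (congrArg ((arcModel n).globalFactor K * ·) h0).trans (mul_zero _)
    refine hz.trans ?_
    symm
    refine finsum_mem_eq_zero_of_forall_eq_zero fun g hg => ?_
    cases (hb K).injOn hg.1.1 hf hg.2
    exact absurd h0 hg.1.2
  · have : {g | g ∈ (arcModel n).contributing K ∧ flowMap K.2 g = flowMap K.2 f} = {f} := by
      ext g
      refine ⟨fun hg => (hb K).injOn hg.1.1 hf hg.2, ?_⟩
      rintro rfl
      exact ⟨⟨hf, h0⟩, rfl⟩
    exact ((congrArg (fun S => ∑ᶠ g ∈ S, (arcModel n).contribution K g) this).trans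
      finsum_mem_singleton).symm

/-! ### The representation and its `R`-matrix -/

/-- The matrix of `K = v ^ H`. -/
def matK (n : ℕ) : Matrix (Fin (n + 1)) (Fin (n + 1)) 𝕂 :=
  Matrix.diagonal fun i => vv ^ wt n i

/-- The matrix of `K⁻¹ = v ^ (-H)`. -/
def matKInv (n : ℕ) : Matrix (Fin (n + 1)) (Fin (n + 1)) 𝕂 :=
  Matrix.diagonal fun i => vv ^ (-wt n i)

/-- `E^r e_i = {n + r - i}_r / {1}^r e_{i-r}`. -/
theorem matE_pow_apply (n r : ℕ) (a i : Fin (n + 1)) :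
    (matE n ^ r) a i = if (a : ℕ) + r = i then
      qPochhammer ((n : ℤ) + r - (i : ℕ)) r / qBracket 1 ^ r else 0 := by
  induction r generalizing a i with
  | zero => simp [Matrix.one_apply, qPochhammer, Fin.ext_iff]
  | succ r ih =>
    rw [pow_succ, Matrix.mul_apply]
    simp only [ih]
    split_ifs with h
    · have hj : (a : ℕ) + r < n + 1 := by omega
      rw [Finset.sum_eq_single ⟨a + r, hj⟩]
      · simp only [if_true, matE, if_pos (show (a : ℕ) + r + 1 = i by omega), qInt]
        have e₁ : (n : ℤ) + (r + 1 : ℕ) - (i : ℕ) = n + r - (a + r : ℕ) := by omega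
        have e₂ : (n : ℤ) + r - (a + r : ℕ) - r = n + 1 - (i : ℕ) := by omega
        rw [e₁, qPochhammer_succ, e₂, pow_succ, div_mul_div_comm]
      · intro j _ hj'
        rw [if_neg, zero_mul]
        exact fun h' => hj' (Fin.ext h'.symm)
      · simp
    · refine Finset.sum_eq_zero fun j _ => ?_
      unfold matE
      split_ifs <;> first | omega | simp

/-- `F^r e_i = {i + r}_r / {1}^r e_{i+r}`. -/
theorem matF_pow_apply (n r : ℕ) (a i : Fin (n + 1)) :
    (matF n ^ r) a i = if (a : ℕ) = i + r then
      qPochhammer ((i : ℕ) + r) r / qBracket 1 ^ r else 0 := by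
  induction r generalizing a i with
  | zero => simp [Matrix.one_apply, qPochhammer, Fin.ext_iff]
  | succ r ih =>
    rw [pow_succ, Matrix.mul_apply]
    simp only [ih]
    split_ifs with h
    · have hj : (i : ℕ) + 1 < n + 1 := by omega
      rw [Finset.sum_eq_single ⟨i + 1, hj⟩]
      · simp only [if_true, matF, if_pos (show (a : ℕ) = i + 1 + r by omega), qInt]
        have e₁ : ((i : ℕ) : ℤ) + (r + 1 : ℕ) = (i + 1 : ℕ) + r := by omega
        have e₂ : ((i + 1 : ℕ) : ℤ) + r - r = (i : ℕ) + 1 := by omega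
        rw [e₁, qPochhammer_succ, e₂, pow_succ, div_mul_div_comm]
      · intro j _ hj'
        have : ¬ ((j : ℕ) = i + 1) := fun h' => hj' (Fin.ext h')
        simp [matF, this]
      · simp
    · refine Finset.sum_eq_zero fun j _ => ?_
      unfold matF
      split_ifs <;> first | omega | simp

theorem matF_pow_eq_zero (n : ℕ) : matF n ^ (n + 1) = 0 := by
  ext a i
  rw [matF_pow_apply, if_neg (by omega)]
  rfl

theorem matK_mul_matE (n : ℕ) : matK n * matE n = vv ^ (2 : ℤ) • (matE n * matK n) := by
  ext a i
  simp only [matK, Matrix.diagonal_mul, Matrix.smul_apply, Matrix.mul_diagonal, smul_eq_mul, matE]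
  split_ifs with h
  · have : wt n a = 2 + wt n i := by simp only [wt]; omega
    rw [this, zpow_add₀ vv_ne_zero]
    ring
  · simp

theorem matKInv_mul_matE (n : ℕ) :
    matKInv n * matE n = vv ^ (-2 : ℤ) • (matE n * matKInv n) := by
  ext a i
  simp only [matKInv, Matrix.diagonal_mul, Matrix.smul_apply, Matrix.mul_diagonal, smul_eq_mul,
    matE]
  split_ifs with h
  · have : -wt n a = -2 + -wt n i := by simp only [wt]; omega
    rw [this, zpow_add₀ vv_ne_zero]
    ring
  · simp

theorem matKInv_mul_matF (n : ℕ) :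
    matKInv n * matF n = vv ^ (2 : ℤ) • (matF n * matKInv n) := by
  ext a i
  simp only [matKInv, Matrix.diagonal_mul, Matrix.smul_apply, Matrix.mul_diagonal, smul_eq_mul,
    matF]
  split_ifs with h
  · have : -wt n a = 2 + -wt n i := by simp only [wt]; omega
    rw [this, zpow_add₀ vv_ne_zero]
    ring
  · simp

theorem qBracket_zero : qBracket 0 = 0 := by simp [qBracket]

/-- The identity of quantum integers behind `[E, F] = (K - K⁻¹) / {1}`. -/
theorem qBracket_identity (n i : ℤ) :
    qBracket (n - i) * qBracket (i + 1) - qBracket (n + 1 - i) * qBracket i =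
      qBracket (n - 2 * i) * qBracket 1 := by
  have h (a b : ℤ) : qBracket a * qBracket b =
      vv ^ (a + b) + vv ^ (-(a + b)) - vv ^ (a - b) - vv ^ (-(a - b)) := by
    simp only [qBracket, sub_mul, mul_sub, ← zpow_add₀ vv_ne_zero]
    ring_nf
  rw [h, h, h]
  ring_nf

theorem matE_mul_matF_apply (n : ℕ) (a i : Fin (n + 1)) :
    (matE n * matF n) a i = if a = i then qInt (n - (i : ℕ)) * qInt ((i : ℕ) + 1) else 0 := by
  rw [Matrix.mul_apply]
  by_cases hi : (i : ℕ) + 1 < n + 1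
  · rw [Finset.sum_eq_single ⟨i + 1, hi⟩]
    · simp only [matE, matF, if_true, add_left_inj, Fin.ext_iff]
      split_ifs
      · congr 2
        push_cast
        ring
      · simp
    · intro j _ hj
      have : ¬ ((j : ℕ) = i + 1) := fun h' => hj (Fin.ext h')
      simp [matF, this]
    · simp
  · have hn : (n : ℤ) - (i : ℕ) = 0 := by omega
    rw [hn, qInt, qBracket_zero]
    simp only [zero_div, zero_mul, ite_self]
    refine Finset.sum_eq_zero fun j _ => ?_
    simp [matF, show ¬ ((j : ℕ) = i + 1) by omega]

theorem matF_mul_matE_apply (n : ℕ) (a i : Fin (n + 1)) :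
    (matF n * matE n) a i = if a = i then qInt (n + 1 - (i : ℕ)) * qInt (i : ℕ) else 0 := by
  rw [Matrix.mul_apply]
  by_cases hi : (i : ℕ) = 0
  · rw [hi, Nat.cast_zero]
    simp only [qInt, qBracket_zero, zero_div, mul_zero, ite_self]
    refine Finset.sum_eq_zero fun j _ => ?_
    simp [matE, show ¬ ((j : ℕ) + 1 = i) by omega]
  · have hi' : (i : ℕ) - 1 < n + 1 := by omega
    rw [Finset.sum_eq_single ⟨i - 1, hi'⟩]
    · have e : (i : ℕ) - 1 + 1 = i := by omega
      have e' : (((i : ℕ) - 1 : ℕ) : ℤ) + 1 = (i : ℕ) := by omega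
      simp only [matE, matF, e, e', if_true, Fin.ext_iff]
      split_ifs
      · ring
      · simp
    · intro j _ hj
      have : ¬ ((j : ℕ) + 1 = i) := fun h' => hj (Fin.ext (by simp only; omega))
      simp [matE, this]
    · simp

theorem matE_mul_matF_sub (n : ℕ) :
    matE n * matF n - matF n * matE n = (qBracket 1)⁻¹ • (matK n - matKInv n) := by
  have h₁ := qBracket_ne_zero one_ne_zero
  ext a i
  rw [Matrix.sub_apply, matE_mul_matF_apply, matF_mul_matE_apply]
  simp only [matK, matKInv, Matrix.smul_apply, Matrix.sub_apply, Matrix.diagonal_apply,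
    smul_eq_mul]
  split_ifs with h
  · subst h
    have := qBracket_identity n (a : ℕ)
    have h₂ : vv ^ wt n a - vv ^ (-wt n a) = qBracket (n - 2 * (a : ℕ)) := rfl
    rw [h₂]
    simp only [qInt]
    field_simp
    linear_combination this
  · simp

theorem matK_mul_matE_pow (n r : ℕ) :
    matK n * matE n ^ r = vv ^ (2 * r : ℤ) • (matE n ^ r * matK n) := by
  induction r with
  | zero => simp
  | succ r ih =>
    have e : (2 * (r + 1 : ℕ) : ℤ) = 2 * r + 2 := by push_cast; ring
    rw [pow_succ, ← mul_assoc, ih, smul_mul_assoc, mul_assoc, matK_mul_matE, mul_smul_comm,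
      smul_smul, ← zpow_add₀ vv_ne_zero, mul_assoc, e]

theorem matKInv_mul_matE_pow (n r : ℕ) :
    matKInv n * matE n ^ r = vv ^ (-(2 * r) : ℤ) • (matE n ^ r * matKInv n) := by
  induction r with
  | zero => simp
  | succ r ih =>
    have e : (-(2 * (r + 1 : ℕ)) : ℤ) = -(2 * r) + -2 := by push_cast; ring
    rw [pow_succ, ← mul_assoc, ih, smul_mul_assoc, mul_assoc, matKInv_mul_matE, mul_smul_comm,
      smul_smul, ← zpow_add₀ vv_ne_zero, mul_assoc, e]

theorem matKInv_mul_matF_pow (n r : ℕ) :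
    matKInv n * matF n ^ r = vv ^ (2 * r : ℤ) • (matF n ^ r * matKInv n) := by
  induction r with
  | zero => simp
  | succ r ih =>
    have e : (2 * (r + 1 : ℕ) : ℤ) = 2 * r + 2 := by push_cast; ring
    rw [pow_succ, ← mul_assoc, ih, smul_mul_assoc, mul_assoc, matKInv_mul_matF, mul_smul_comm,
      smul_smul, ← zpow_add₀ vv_ne_zero, mul_assoc, e]

/-- `[E^{r+1}, F] = ([r+1] / {1}) E^r (v^r K - v^{-r} K⁻¹)`. -/
theorem matE_pow_mul_matF_sub (n r : ℕ) :
    matE n ^ (r + 1) * matF n - matF n * matE n ^ (r + 1) =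
      (qInt (r + 1) / qBracket 1) •
        (matE n ^ r * (vv ^ (r : ℤ) • matK n - vv ^ (-r : ℤ) • matKInv n)) := by
  have h₁ := qBracket_ne_zero one_ne_zero
  induction r with
  | zero =>
    have : qInt ((0 : ℕ) + 1) / qBracket 1 = (qBracket 1)⁻¹ := by
      rw [qInt, Nat.cast_zero, zero_add, div_self h₁, one_div]
    rw [this]
    simpa using matE_mul_matF_sub n
  | succ r ih =>
    have e : matE n ^ (r + 1 + 1) * matF n - matF n * matE n ^ (r + 1 + 1) =
        matE n * (matE n ^ (r + 1) * matF n - matF n * matE n ^ (r + 1)) +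
          (matE n * matF n - matF n * matE n) * matE n ^ (r + 1) := by
      rw [pow_succ' _ (r + 1)]
      noncomm_ring
    rw [e, ih, matE_mul_matF_sub, smul_mul_assoc, sub_mul, matK_mul_matE_pow,
      matKInv_mul_matE_pow, mul_smul_comm, ← mul_assoc, ← pow_succ', mul_sub, mul_sub,
      mul_smul_comm, mul_smul_comm, mul_smul_comm, mul_smul_comm]
    generalize matE n ^ (r + 1) * matK n = X
    generalize matE n ^ (r + 1) * matKInv n = Y
    have hv := vv_ne_zero
    have c₁ : qInt (r + 1) * vv ^ (r : ℤ) + vv ^ (2 * (r + 1 : ℕ) : ℤ) =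
        qInt ((r + 1 : ℕ) + 1) * vv ^ ((r + 1 : ℕ) : ℤ) := by
      simp only [qInt]
      field_simp
      simp only [qBracket, sub_mul, ← zpow_add₀ hv]
      push_cast
      ring_nf
    have c₂ : qInt (r + 1) * vv ^ (-r : ℤ) + vv ^ (-(2 * (r + 1 : ℕ)) : ℤ) =
        qInt ((r + 1 : ℕ) + 1) * vv ^ (-(r + 1 : ℕ) : ℤ) := by
      simp only [qInt]
      field_simp
      simp only [qBracket, sub_mul, ← zpow_add₀ hv]
      push_cast
      ring_nf
    ext a i
    simp only [Matrix.add_apply, Matrix.sub_apply, Matrix.smul_apply, smul_eq_mul]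
    linear_combination (X a i / qBracket 1) * c₁ - (Y a i / qBracket 1) * c₂

/-- The quasi-`R`-matrix with coefficients `c`. -/
def quasiR (n : ℕ) (c : ℕ → 𝕂) :
    Matrix (Fin (n + 1) × Fin (n + 1)) (Fin (n + 1) × Fin (n + 1)) 𝕂 :=
  ∑ r ∈ Finset.range (n + 1), c r • ((matE n ^ r) ⊗ₖ (matF n ^ r))

/-- The commutator of a quasi-`R`-matrix with `F ⊗ 1`. -/
theorem quasiR_mul_sub (n : ℕ) (c : ℕ → 𝕂) :
    quasiR n c * (matF n ⊗ₖ 1) - (matF n ⊗ₖ 1) * quasiR n c =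
      ∑ r ∈ Finset.range n, (c (r + 1) * qInt (r + 1) / qBracket 1) •
        ((matE n ^ r * (vv ^ (r : ℤ) • matK n - vv ^ (-r : ℤ) • matKInv n)) ⊗ₖ
          (matF n ^ (r + 1))) := by
  have h : ∀ r, (c r • ((matE n ^ r) ⊗ₖ (matF n ^ r))) * (matF n ⊗ₖ 1) -
      (matF n ⊗ₖ 1) * (c r • ((matE n ^ r) ⊗ₖ (matF n ^ r))) =
      c r • ((matE n ^ r * matF n - matF n * matE n ^ r) ⊗ₖ (matF n ^ r)) := by
    intro r
    rw [smul_mul_assoc, mul_smul_comm, ← Matrix.mul_kronecker_mul, ← Matrix.mul_kronecker_mul,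
      mul_one, one_mul, ← smul_sub]
    congr 1
    ext x y
    simp [Matrix.kroneckerMap_apply, sub_mul]
  rw [quasiR, Finset.sum_mul, Finset.mul_sum, ← Finset.sum_sub_distrib,
    Finset.sum_congr rfl fun r _ => h r, Finset.sum_range_succ']
  have h0 : c 0 • ((matE n ^ 0 * matF n - matF n * matE n ^ 0) ⊗ₖ (matF n ^ 0)) = 0 := by
    ext x y
    simp
  rw [h0, add_zero]
  refine Finset.sum_congr rfl fun r _ => ?_
  rw [matE_pow_mul_matF_sub, Matrix.smul_kronecker, smul_smul, mul_div_assoc]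

theorem quasiR_mul_kronecker_matF (n : ℕ) (c : ℕ → 𝕂)
    (A : Matrix (Fin (n + 1)) (Fin (n + 1)) 𝕂) :
    quasiR n c * (A ⊗ₖ matF n) =
      ∑ r ∈ Finset.range n, c r • ((matE n ^ r * A) ⊗ₖ (matF n ^ (r + 1))) := by
  -- The top summand vanishes because `F ^ (n + 1) = 0`.
  rw [quasiR, Finset.sum_mul, Finset.sum_range_succ]
  simp only [smul_mul_assoc, ← Matrix.mul_kronecker_mul, ← pow_succ, matF_pow_eq_zero]
  simp

theorem kronecker_matF_mul_quasiR (n : ℕ) (c : ℕ → 𝕂)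
    (A : Matrix (Fin (n + 1)) (Fin (n + 1)) 𝕂) :
    (A ⊗ₖ matF n) * quasiR n c =
      ∑ r ∈ Finset.range n, c r • ((A * matE n ^ r) ⊗ₖ (matF n ^ (r + 1))) := by
  -- The top summand vanishes because `F ^ (n + 1) = 0`.
  rw [quasiR, Finset.mul_sum, Finset.sum_range_succ]
  simp only [mul_smul_comm, ← Matrix.mul_kronecker_mul, ← pow_succ', matF_pow_eq_zero]
  simp

/-- The quasi-`R`-matrix intertwines the two bar-conjugate coproducts of `F`. -/
theorem quasiR_intertwines (n : ℕ) {c : ℕ → 𝕂}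
    (hc : ∀ r : ℕ, c (r + 1) * qInt (r + 1) = -(vv ^ (-r : ℤ) * qBracket 1 * c r)) :
    quasiR n c * (matF n ⊗ₖ 1 + matK n ⊗ₖ matF n) =
      (matF n ⊗ₖ 1 + matKInv n ⊗ₖ matF n) * quasiR n c := by
  have h₁ := qBracket_ne_zero one_ne_zero
  have hv := vv_ne_zero
  have h := quasiR_mul_sub n c
  rw [mul_add, add_mul, quasiR_mul_kronecker_matF, kronecker_matF_mul_quasiR,
    ← sub_eq_zero, add_sub_add_comm, h, ← Finset.sum_sub_distrib, ← Finset.sum_add_distrib]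
  refine Finset.sum_eq_zero fun r _ => ?_
  rw [hc, matKInv_mul_matE_pow, mul_sub, mul_smul_comm, mul_smul_comm]
  generalize matE n ^ r * matK n = X
  generalize matE n ^ r * matKInv n = Y
  have e₁ : vv ^ (-r : ℤ) * vv ^ (r : ℤ) = 1 := by
    rw [← zpow_add₀ hv, neg_add_cancel, zpow_zero]
  have e₂ : vv ^ (-r : ℤ) * vv ^ (-r : ℤ) = vv ^ (-(2 * r) : ℤ) := by
    rw [← zpow_add₀ hv]; ring_nf
  ext x y
  simp only [Matrix.add_apply, Matrix.sub_apply, Matrix.smul_apply, smul_eq_mul,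
    Matrix.kroneckerMap_apply, Matrix.zero_apply]
  field_simp
  linear_combination (-(c r * X x.1 y.1 * (matF n ^ (r + 1)) x.2 y.2)) * e₁ +
    c r * Y x.1 y.1 * (matF n ^ (r + 1)) x.2 y.2 * e₂

/-- The version of `quasiR_intertwines` for the inverse of the quasi-`R`-matrix, whose
coefficients satisfy the bar-conjugate recursion. -/
theorem quasiR_intertwines_inv (n : ℕ) {c : ℕ → 𝕂}
    (hc : ∀ r : ℕ, c (r + 1) * qInt (r + 1) = vv ^ (r : ℤ) * qBracket 1 * c r) :
    quasiR n c * (matF n ⊗ₖ 1 + matKInv n ⊗ₖ matF n) =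
      (matF n ⊗ₖ 1 + matK n ⊗ₖ matF n) * quasiR n c := by
  have h₁ := qBracket_ne_zero one_ne_zero
  have hv := vv_ne_zero
  have h := quasiR_mul_sub n c
  rw [mul_add, add_mul, quasiR_mul_kronecker_matF, kronecker_matF_mul_quasiR,
    ← sub_eq_zero, add_sub_add_comm, h, ← Finset.sum_sub_distrib, ← Finset.sum_add_distrib]
  refine Finset.sum_eq_zero fun r _ => ?_
  rw [hc, matK_mul_matE_pow, mul_sub, mul_smul_comm, mul_smul_comm]
  generalize matE n ^ r * matK n = X
  generalize matE n ^ r * matKInv n = Y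
  have e₁ : vv ^ (r : ℤ) * vv ^ (-r : ℤ) = 1 := by
    rw [← zpow_add₀ hv, add_neg_cancel, zpow_zero]
  have e₂ : vv ^ (r : ℤ) * vv ^ (r : ℤ) = vv ^ (2 * r : ℤ) := by
    rw [← zpow_add₀ hv]; ring_nf
  ext x y
  simp only [Matrix.add_apply, Matrix.sub_apply, Matrix.smul_apply, smul_eq_mul,
    Matrix.kroneckerMap_apply, Matrix.zero_apply]
  field_simp
  linear_combination (-(c r * Y x.1 y.1 * (matF n ^ (r + 1)) x.2 y.2)) * e₁ +
    c r * X x.1 y.1 * (matF n ^ (r + 1)) x.2 y.2 * e₂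

theorem commute_quasiR (n : ℕ) (c : ℕ → 𝕂) :
    Commute (matKInv n ⊗ₖ matKInv n) (quasiR n c) := by
  refine Commute.sum_right _ _ _ fun r _ => Commute.smul_right ?_ _
  rw [Commute, SemiconjBy, ← Matrix.mul_kronecker_mul, ← Matrix.mul_kronecker_mul,
    matKInv_mul_matE_pow, matKInv_mul_matF_pow, Matrix.smul_kronecker, Matrix.kronecker_smul,
    smul_smul, ← zpow_add₀ vv_ne_zero, neg_add_cancel, zpow_zero, one_smul]

theorem commute_cartanPart (n : ℕ) (c : ℤ) :
    Commute (matKInv n ⊗ₖ matKInv n) (cartanPart n c) := by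
  rw [matKInv, Matrix.diagonal_kronecker_diagonal, cartanPart, Commute, SemiconjBy,
    Matrix.diagonal_mul_diagonal, Matrix.diagonal_mul_diagonal]
  simp only [mul_comm]

theorem cartanPart_mul_matF_left (n : ℕ) :
    cartanPart n (-1) * (matF n ⊗ₖ matKInv n) = (matF n ⊗ₖ 1) * cartanPart n (-1) := by
  ext ⟨a, b⟩ ⟨i, j⟩
  simp only [cartanPart, Matrix.diagonal_mul, Matrix.mul_diagonal, Matrix.kroneckerMap_apply,
    matKInv, Matrix.diagonal_apply, Matrix.one_apply, matF]
  by_cases h₁ : (a : ℕ) = i + 1 <;> by_cases h₂ : b = j <;> simp only [h₁, h₂, if_true, if_false]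
  · have e : wt n a = wt n i - 2 := by simp only [wt]; omega
    have : tRoot ^ (-1 * (wt n a * wt n j)) * vv ^ (-wt n j) =
        tRoot ^ (-1 * (wt n i * wt n j)) := by
      rw [vv_zpow, ← zpow_add₀ tRoot_ne_zero, e]
      ring_nf
    linear_combination qInt ((i : ℕ) + 1) * this
  all_goals ring

theorem cartanPart_mul_matF_right (n : ℕ) :
    cartanPart n (-1) * (1 ⊗ₖ matF n) = (matK n ⊗ₖ matF n) * cartanPart n (-1) := by
  ext ⟨a, b⟩ ⟨i, j⟩
  simp only [cartanPart, Matrix.diagonal_mul, Matrix.mul_diagonal, Matrix.kroneckerMap_apply,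
    matK, Matrix.diagonal_apply, Matrix.one_apply, matF]
  by_cases h₁ : (b : ℕ) = j + 1 <;> by_cases h₂ : a = i <;> simp only [h₁, h₂, if_true, if_false]
  · have e : wt n b = wt n j - 2 := by simp only [wt]; omega
    have : tRoot ^ (-1 * (wt n i * wt n b)) =
        vv ^ (wt n i) * tRoot ^ (-1 * (wt n i * wt n j)) := by
      rw [vv_zpow, ← zpow_add₀ tRoot_ne_zero, e]
      ring_nf
    linear_combination qInt ((j : ℕ) + 1) * this
  all_goals ring

theorem cartanPart_one_mul_matF_left (n : ℕ) :
    cartanPart n 1 * (matF n ⊗ₖ 1) = (matF n ⊗ₖ matKInv n) * cartanPart n 1 := by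
  ext ⟨a, b⟩ ⟨i, j⟩
  simp only [cartanPart, Matrix.diagonal_mul, Matrix.mul_diagonal, Matrix.kroneckerMap_apply,
    matKInv, Matrix.diagonal_apply, Matrix.one_apply, matF]
  by_cases h₁ : (a : ℕ) = i + 1 <;> by_cases h₂ : b = j <;> simp only [h₁, h₂, if_true, if_false]
  · have e : wt n a = wt n i - 2 := by simp only [wt]; omega
    have : tRoot ^ (1 * (wt n a * wt n j)) =
        vv ^ (-wt n j) * tRoot ^ (1 * (wt n i * wt n j)) := by
      rw [vv_zpow, ← zpow_add₀ tRoot_ne_zero, e]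
      ring_nf
    linear_combination qInt ((i : ℕ) + 1) * this
  all_goals ring

theorem cartanPart_one_mul_matF_right (n : ℕ) :
    cartanPart n 1 * (matK n ⊗ₖ matF n) = (1 ⊗ₖ matF n) * cartanPart n 1 := by
  ext ⟨a, b⟩ ⟨i, j⟩
  simp only [cartanPart, Matrix.diagonal_mul, Matrix.mul_diagonal, Matrix.kroneckerMap_apply,
    matK, Matrix.diagonal_apply, Matrix.one_apply, matF]
  by_cases h₁ : (b : ℕ) = j + 1 <;> by_cases h₂ : a = i <;> simp only [h₁, h₂, if_true, if_false]
  · have e : wt n b = wt n j - 2 := by simp only [wt]; omega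
    have : tRoot ^ (1 * (wt n i * wt n b)) * vv ^ (wt n i) =
        tRoot ^ (1 * (wt n i * wt n j)) := by
      rw [vv_zpow, ← zpow_add₀ tRoot_ne_zero, e]
      ring_nf
    linear_combination qInt ((j : ℕ) + 1) * this
  all_goals ring

theorem qFactorial_succ (r : ℕ) : qFactorial (r + 1) = qFactorial r * qInt (r + 1) := by
  rw [qFactorial, Finset.prod_range_succ]; rfl

theorem qFactorial_ne_zero (r : ℕ) : qFactorial r ≠ 0 :=
  Finset.prod_ne_zero_iff.2 fun s _ => qInt_ne_zero (by omega)

theorem matR_eq (n : ℕ) : matR n = quasiR n (fun r => (-1) ^ r * tRoot ^ (-((r : ℤ) * (r - 1))) *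
    qBracket 1 ^ r / qFactorial r) * cartanPart n (-1) := rfl

theorem matRInv_eq (n : ℕ) : matRInv n = cartanPart n 1 *
    quasiR n (fun r => tRoot ^ ((r : ℤ) * (r - 1)) * qBracket 1 ^ r / qFactorial r) := rfl

/-- The coproduct of `F` acting on two factors. -/
def coprodF (n : ℕ) : Matrix (Fin (n + 1) × Fin (n + 1)) (Fin (n + 1) × Fin (n + 1)) 𝕂 :=
  matF n ⊗ₖ matKInv n + 1 ⊗ₖ matF n

/-- The opposite coproduct of `F` acting on two factors. -/
def coprodFOp (n : ℕ) : Matrix (Fin (n + 1) × Fin (n + 1)) (Fin (n + 1) × Fin (n + 1)) 𝕂 :=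
  matF n ⊗ₖ 1 + matKInv n ⊗ₖ matF n

/-- The `R`-matrix intertwines the coproduct of `F` and its opposite: moving `F` past the
Cartan part changes the powers of `K`, and the quasi-`R`-matrix does the rest. -/
theorem matR_mul_coprodF (n : ℕ) : matR n * coprodF n = coprodFOp n * matR n := by
  have h : ∀ r : ℕ, ((-1) ^ (r + 1) * tRoot ^ (-(((r + 1 : ℕ) : ℤ) * ((r + 1 : ℕ) - 1))) *
      qBracket 1 ^ (r + 1) / qFactorial (r + 1)) * qInt (r + 1) =
      -(vv ^ (-r : ℤ) * qBracket 1 * ((-1) ^ r * tRoot ^ (-((r : ℤ) * (r - 1))) *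
        qBracket 1 ^ r / qFactorial r)) := by
    intro r
    have h₁ : qInt ((r : ℤ) + 1) ≠ 0 := qInt_ne_zero (by omega)
    have h₂ := qFactorial_ne_zero r
    have h₃ : tRoot ^ (-(((r + 1 : ℕ) : ℤ) * ((r + 1 : ℕ) - 1))) =
        vv ^ (-r : ℤ) * tRoot ^ (-((r : ℤ) * (r - 1))) := by
      rw [vv_zpow, ← zpow_add₀ tRoot_ne_zero]
      congr 1
      push_cast
      ring
    rw [qFactorial_succ, h₃]
    generalize vv ^ (-r : ℤ) = x
    generalize tRoot ^ (-((r : ℤ) * (r - 1))) = y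
    field_simp
    ring
  have h' := quasiR_intertwines n (c := fun r => (-1) ^ r * tRoot ^ (-((r : ℤ) * (r - 1))) *
    qBracket 1 ^ r / qFactorial r) h
  rw [matR_eq, coprodF, coprodFOp, ← mul_assoc, ← h', mul_assoc, mul_assoc, mul_add,
    cartanPart_mul_matF_left, cartanPart_mul_matF_right, add_mul]

theorem matRInv_mul_coprodFOp (n : ℕ) : matRInv n * coprodFOp n = coprodF n * matRInv n := by
  have h : ∀ r : ℕ, (tRoot ^ (((r + 1 : ℕ) : ℤ) * ((r + 1 : ℕ) - 1)) *
      qBracket 1 ^ (r + 1) / qFactorial (r + 1)) * qInt (r + 1) =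
      vv ^ (r : ℤ) * qBracket 1 * (tRoot ^ ((r : ℤ) * (r - 1)) *
        qBracket 1 ^ r / qFactorial r) := by
    intro r
    have h₁ : qInt ((r : ℤ) + 1) ≠ 0 := qInt_ne_zero (by omega)
    have h₂ := qFactorial_ne_zero r
    have h₃ : tRoot ^ (((r + 1 : ℕ) : ℤ) * ((r + 1 : ℕ) - 1)) =
        vv ^ (r : ℤ) * tRoot ^ ((r : ℤ) * (r - 1)) := by
      rw [vv_zpow, ← zpow_add₀ tRoot_ne_zero]
      congr 1
      push_cast
      ring
    rw [qFactorial_succ, h₃]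
    generalize vv ^ (r : ℤ) = x
    generalize tRoot ^ ((r : ℤ) * (r - 1)) = y
    field_simp
    ring
  have h' := quasiR_intertwines_inv n (c := fun r => tRoot ^ ((r : ℤ) * (r - 1)) *
    qBracket 1 ^ r / qFactorial r) h
  rw [matRInv_eq, coprodF, coprodFOp, mul_assoc, h', ← mul_assoc, ← mul_assoc, mul_add,
    cartanPart_one_mul_matF_left, cartanPart_one_mul_matF_right, add_mul, add_mul, add_mul]

theorem coprodF_submatrix_swap (n : ℕ) :
    (coprodF n).submatrix Prod.swap Prod.swap = coprodFOp n := by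
  ext ⟨a, b⟩ ⟨i, j⟩
  simp only [coprodF, coprodFOp, Matrix.submatrix_apply, Matrix.add_apply,
    Matrix.kroneckerMap_apply, Prod.swap_prod_mk]
  ring

theorem coprodFOp_submatrix_swap (n : ℕ) :
    (coprodFOp n).submatrix Prod.swap Prod.swap = coprodF n := by
  rw [← coprodF_submatrix_swap, Matrix.submatrix_submatrix, Prod.swap_swap_eq,
    Matrix.submatrix_id_id]

theorem braiding_one (n : ℕ) : braiding n 1 = (matR n).submatrix Prod.swap id := by
  ext y x
  simp [braiding, Prod.swap]

theorem braiding_neg_one (n : ℕ) : braiding n (-1) = (matRInv n).submatrix id Prod.swap := by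
  ext y x
  simp [braiding, Prod.swap]

/-- The operator of a crossing intertwines the action of `F`. -/
theorem commute_braiding_coprodF (n : ℕ) (ε : ℤˣ) : Commute (braiding n ε) (coprodF n) := by
  rw [Commute, SemiconjBy]
  rcases Int.units_eq_one_or ε with rfl | rfl
  · calc braiding n 1 * coprodF n
        = (matR n).submatrix Prod.swap (Equiv.refl _) *
            (coprodF n).submatrix (Equiv.refl _) id := by rw [braiding_one]; rfl
      _ = (matR n * coprodF n).submatrix Prod.swap id := Matrix.submatrix_mul_equiv ..
      _ = (coprodFOp n * matR n).submatrix Prod.swap id := by rw [matR_mul_coprodF]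
      _ = (coprodFOp n).submatrix Prod.swap (Equiv.prodComm _ _) *
            (matR n).submatrix (Equiv.prodComm _ _) id :=
          (Matrix.submatrix_mul_equiv ..).symm
      _ = coprodF n * braiding n 1 := by rw [braiding_one, ← coprodFOp_submatrix_swap]; rfl
  · calc braiding n (-1) * coprodF n
        = (matRInv n).submatrix id (Equiv.prodComm _ _) *
            (coprodFOp n).submatrix (Equiv.prodComm _ _) Prod.swap := by
          rw [braiding_neg_one, ← coprodFOp_submatrix_swap]; rfl
      _ = (matRInv n * coprodFOp n).submatrix id Prod.swap := Matrix.submatrix_mul_equiv ..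
      _ = (coprodF n * matRInv n).submatrix id Prod.swap := by rw [matRInv_mul_coprodFOp]
      _ = (coprodF n).submatrix id (Equiv.refl _) *
            (matRInv n).submatrix (Equiv.refl _) Prod.swap :=
          (Matrix.submatrix_mul_equiv ..).symm
      _ = coprodF n * braiding n (-1) := by rw [braiding_neg_one]; rfl

/-- The operator of a crossing preserves the weight. -/
theorem commute_braiding_matKInv (n : ℕ) (ε : ℤˣ) :
    Commute (braiding n ε) (matKInv n ⊗ₖ matKInv n) := by
  have hsw : (matKInv n ⊗ₖ matKInv n).submatrix Prod.swap Prod.swap =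
      matKInv n ⊗ₖ matKInv n := by
    ext x y
    simp [Matrix.kroneckerMap_apply, mul_comm]
  have h₁ : Commute (matR n) (matKInv n ⊗ₖ matKInv n) := by
    rw [matR_eq]
    exact ((commute_quasiR n _).mul_right (commute_cartanPart n _)).symm
  have h₂ : Commute (matRInv n) (matKInv n ⊗ₖ matKInv n) := by
    rw [matRInv_eq]
    exact ((commute_cartanPart n _).mul_right (commute_quasiR n _)).symm
  rw [Commute, SemiconjBy]
  rcases Int.units_eq_one_or ε with rfl | rfl
  · calc braiding n 1 * (matKInv n ⊗ₖ matKInv n)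
        = (matR n).submatrix Prod.swap (Equiv.refl _) *
            (matKInv n ⊗ₖ matKInv n).submatrix (Equiv.refl _) id := by rw [braiding_one]; rfl
      _ = (matR n * (matKInv n ⊗ₖ matKInv n)).submatrix Prod.swap id :=
          Matrix.submatrix_mul_equiv ..
      _ = ((matKInv n ⊗ₖ matKInv n) * matR n).submatrix Prod.swap id := by rw [h₁.eq]
      _ = (matKInv n ⊗ₖ matKInv n).submatrix Prod.swap (Equiv.prodComm _ _) *
            (matR n).submatrix (Equiv.prodComm _ _) id :=
          (Matrix.submatrix_mul_equiv ..).symm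
      _ = (matKInv n ⊗ₖ matKInv n) * braiding n 1 := by
          rw [braiding_one]; exact congrArg (· * _) hsw
  · calc braiding n (-1) * (matKInv n ⊗ₖ matKInv n)
        = (matRInv n).submatrix id (Equiv.prodComm _ _) *
            (matKInv n ⊗ₖ matKInv n).submatrix (Equiv.prodComm _ _) Prod.swap := by
          rw [braiding_neg_one]; exact congrArg (_ * ·) hsw.symm
      _ = (matRInv n * (matKInv n ⊗ₖ matKInv n)).submatrix id Prod.swap :=
          Matrix.submatrix_mul_equiv ..
      _ = ((matKInv n ⊗ₖ matKInv n) * matRInv n).submatrix id Prod.swap := by rw [h₂.eq]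
      _ = (matKInv n ⊗ₖ matKInv n).submatrix id (Equiv.refl _) *
            (matRInv n).submatrix (Equiv.refl _) Prod.swap :=
          (Matrix.submatrix_mul_equiv ..).symm
      _ = (matKInv n ⊗ₖ matKInv n) * braiding n (-1) := by rw [braiding_neg_one]; rfl

/-! ### The operator of a braid commutes with the action of `F` -/

/-- The tensor product of a family of matrices. -/
def tensorMat {m : ℕ} (n : ℕ) (τ : Fin m → Matrix (Fin (n + 1)) (Fin (n + 1)) 𝕂) :
    Matrix (Fin m → Fin (n + 1)) (Fin m → Fin (n + 1)) 𝕂 :=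
  fun y x => ∏ q, τ q (y q) (x q)

/-- The part of a matrix entry of a tensor product that belongs to the strands which do not take
part in a crossing. -/
def restProd (n : ℕ) (i : Fin m) (τ : Fin (m + 1) → Matrix (Fin (n + 1)) (Fin (n + 1)) 𝕂)
    (y x : Fin (m + 1) → Fin (n + 1)) : 𝕂 :=
  ∏ q with q ≠ i.castSucc ∧ q ≠ i.succ, τ q (y q) (x q)

theorem tensorMat_eq (n : ℕ) (i : Fin m)
    (τ : Fin (m + 1) → Matrix (Fin (n + 1)) (Fin (n + 1)) 𝕂) (y x : Fin (m + 1) → Fin (n + 1)) :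
    tensorMat n τ y x = restProd n i τ y x *
      (τ i.castSucc ⊗ₖ τ i.succ) (y i.castSucc, y i.succ) (x i.castSucc, x i.succ) := by
  rw [tensorMat, restProd, Matrix.kroneckerMap_apply,
    ← Finset.prod_filter_mul_prod_filter_not _ fun q => q ≠ i.castSucc ∧ q ≠ i.succ]
  congr 1
  have : Finset.univ.filter (fun q => ¬ (q ≠ i.castSucc ∧ q ≠ i.succ)) =
      {i.castSucc, i.succ} := by
    ext q
    simp only [Finset.mem_filter, Finset.mem_univ, true_and, Finset.mem_insert,
      Finset.mem_singleton]
    tauto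
  rw [this, Finset.prod_pair (Fin.castSucc_lt_succ).ne]

/-- The tuple that agrees with `y` away from a crossing and has prescribed values there. -/
def setPair {n : ℕ} (i : Fin m) (y : Fin (m + 1) → Fin (n + 1)) (c : Fin (n + 1) × Fin (n + 1)) :
    Fin (m + 1) → Fin (n + 1) :=
  Function.update (Function.update y i.castSucc c.1) i.succ c.2

theorem setPair_castSucc {n : ℕ} (i : Fin m) (y : Fin (m + 1) → Fin (n + 1))
    (c : Fin (n + 1) × Fin (n + 1)) : setPair i y c i.castSucc = c.1 := by
  rw [setPair, Function.update_of_ne (Fin.castSucc_lt_succ).ne, Function.update_self]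

theorem setPair_succ {n : ℕ} (i : Fin m) (y : Fin (m + 1) → Fin (n + 1))
    (c : Fin (n + 1) × Fin (n + 1)) : setPair i y c i.succ = c.2 := by
  rw [setPair, Function.update_self]

theorem setPair_of_ne {n : ℕ} (i : Fin m) (y : Fin (m + 1) → Fin (n + 1))
    (c : Fin (n + 1) × Fin (n + 1)) {q : Fin (m + 1)} (h₁ : q ≠ i.castSucc) (h₂ : q ≠ i.succ) :
    setPair i y c q = y q := by
  rw [setPair, Function.update_of_ne h₂, Function.update_of_ne h₁]

theorem setPair_injective {n : ℕ} (i : Fin m) (y : Fin (m + 1) → Fin (n + 1)) :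
    Function.Injective (setPair i y) := fun c d h =>
  Prod.ext (by rw [← setPair_castSucc i y c, h, setPair_castSucc])
    (by rw [← setPair_succ i y c, h, setPair_succ])

theorem mem_range_setPair {n : ℕ} (i : Fin m) {y z : Fin (m + 1) → Fin (n + 1)}
    (h : ∀ q, q ≠ i.castSucc → q ≠ i.succ → z q = y q) : z ∈ Set.range (setPair i y) := by
  refine ⟨(z i.castSucc, z i.succ), funext fun q => ?_⟩
  by_cases h₁ : q = i.castSucc
  · rw [h₁, setPair_castSucc]
  · by_cases h₂ : q = i.succ
    · rw [h₂, setPair_succ]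
    · rw [setPair_of_ne i y _ h₁ h₂, h q h₁ h₂]

/-- A braid generator acts on a tensor product only through the two factors at the crossing. -/
theorem letterOp_mul_tensorMat (n : ℕ) (g : Fin m × ℤˣ)
    (τ : Fin (m + 1) → Matrix (Fin (n + 1)) (Fin (n + 1)) 𝕂) (y x : Fin (m + 1) → Fin (n + 1)) :
    (letterOp n g * tensorMat n τ) y x = restProd n g.1 τ y x *
      (braiding n g.2 * (τ g.1.castSucc ⊗ₖ τ g.1.succ))
        (y g.1.castSucc, y g.1.succ) (x g.1.castSucc, x g.1.succ) := by
  rw [Matrix.mul_apply, Matrix.mul_apply, Finset.mul_sum]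
  symm
  refine Fintype.sum_of_injective (setPair g.1 y) (setPair_injective g.1 y) _ _ ?_ ?_
  · intro z hz
    rw [letterOp, if_neg, zero_mul]
    exact fun h => hz (mem_range_setPair g.1 fun q h₁ h₂ => (h q h₁ h₂).symm)
  · intro c
    rw [letterOp, if_pos fun q h₁ h₂ => (setPair_of_ne g.1 y c h₁ h₂).symm,
      tensorMat_eq n g.1, setPair_castSucc, setPair_succ]
    have : restProd n g.1 τ (setPair g.1 y c) x = restProd n g.1 τ y x := by
      refine Finset.prod_congr rfl fun q hq => ?_
      rw [Finset.mem_filter] at hq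
      rw [setPair_of_ne g.1 y c hq.2.1 hq.2.2]
    rw [this]
    ring

theorem tensorMat_mul_letterOp (n : ℕ) (g : Fin m × ℤˣ)
    (τ : Fin (m + 1) → Matrix (Fin (n + 1)) (Fin (n + 1)) 𝕂) (y x : Fin (m + 1) → Fin (n + 1)) :
    (tensorMat n τ * letterOp n g) y x = restProd n g.1 τ y x *
      ((τ g.1.castSucc ⊗ₖ τ g.1.succ) * braiding n g.2)
        (y g.1.castSucc, y g.1.succ) (x g.1.castSucc, x g.1.succ) := by
  rw [Matrix.mul_apply, Matrix.mul_apply, Finset.mul_sum]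
  symm
  refine Fintype.sum_of_injective (setPair g.1 x) (setPair_injective g.1 x) _ _ ?_ ?_
  · intro z hz
    rw [letterOp, if_neg, mul_zero]
    exact fun h => hz (mem_range_setPair g.1 h)
  · intro c
    rw [letterOp, if_pos fun q h₁ h₂ => setPair_of_ne g.1 x c h₁ h₂,
      tensorMat_eq n g.1, setPair_castSucc, setPair_succ]
    have : restProd n g.1 τ y (setPair g.1 x c) = restProd n g.1 τ y x := by
      refine Finset.prod_congr rfl fun q hq => ?_
      rw [Finset.mem_filter] at hq
      rw [setPair_of_ne g.1 x c hq.2.1 hq.2.2]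
    rw [this]
    ring

/-- The tensor factor at position `q` of the summand of the iterated coproduct of `F` in which `F`
acts at position `p`. -/
def coprodFactor {m : ℕ} (n : ℕ) (p q : Fin m) : Matrix (Fin (n + 1)) (Fin (n + 1)) 𝕂 :=
  if q < p then 1 else if q = p then matF n else matKInv n

/-- The action of `F` on the tensor power, `∑_p 1 ⊗ ⋯ ⊗ 1 ⊗ F ⊗ K⁻¹ ⊗ ⋯ ⊗ K⁻¹`. -/
def tensorF (m n : ℕ) : Matrix (Fin m → Fin (n + 1)) (Fin m → Fin (n + 1)) 𝕂 :=
  ∑ p, tensorMat n (coprodFactor n p)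

/-- The summands of the iterated coproduct in which `F` acts at one of the two strands of the
crossing combine to the coproduct on two factors; in all others the two strands carry `1 ⊗ 1`
or `K⁻¹ ⊗ K⁻¹`. -/
theorem commute_letterOp_tensorF (n : ℕ) (g : Fin m × ℤˣ) :
    Commute (tensorF (m + 1) n) (letterOp n g) := by
  obtain ⟨i, ε⟩ := g
  rw [Commute, SemiconjBy, tensorF, Finset.sum_mul, Finset.mul_sum]
  ext y x
  rw [← sub_eq_zero, Matrix.sum_apply, Matrix.sum_apply, ← Finset.sum_sub_distrib,
    Fintype.sum_eq_add i.castSucc i.succ (Fin.castSucc_lt_succ).ne]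
  · have hr : restProd n i (coprodFactor n i.succ) y x =
        restProd n i (coprodFactor n i.castSucc) y x := by
      refine Finset.prod_congr rfl fun q hq => ?_
      simp only [Finset.mem_filter, Finset.mem_univ, true_and, ne_eq, Fin.ext_iff,
        Fin.val_castSucc, Fin.val_succ] at hq
      have h : q < i.succ ↔ q < i.castSucc := by
        simp only [Fin.lt_def, Fin.val_castSucc, Fin.val_succ]; omega
      have h₁ : q ≠ i.succ := by simp only [ne_eq, Fin.ext_iff, Fin.val_succ]; omega
      have h₂ : q ≠ i.castSucc := by simp only [ne_eq, Fin.ext_iff, Fin.val_castSucc]; omega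
      simp only [coprodFactor, h, h₁, h₂, if_false]
    have f₁ : coprodFactor n i.castSucc i.castSucc = matF n := by simp [coprodFactor]
    have f₂ : coprodFactor n i.castSucc i.succ = matKInv n := by
      rw [coprodFactor, if_neg (Fin.castSucc_lt_succ).not_gt, if_neg (Fin.castSucc_lt_succ).ne']
    have f₃ : coprodFactor n i.succ i.castSucc = 1 := by
      rw [coprodFactor, if_pos Fin.castSucc_lt_succ]
    have f₄ : coprodFactor n i.succ i.succ = matF n := by simp [coprodFactor]
    have h := congrFun (congrFun (commute_braiding_coprodF n ε).eq
      (y i.castSucc, y i.succ)) (x i.castSucc, x i.succ)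
    rw [coprodF, mul_add, add_mul, Matrix.add_apply, Matrix.add_apply] at h
    rw [letterOp_mul_tensorMat, letterOp_mul_tensorMat, tensorMat_mul_letterOp,
      tensorMat_mul_letterOp, hr]
    simp only [f₁, f₂, f₃, f₄]
    linear_combination (-restProd n i (coprodFactor n i.castSucc) y x) * h
  · rintro p ⟨hp₁, hp₂⟩
    rw [letterOp_mul_tensorMat, tensorMat_mul_letterOp, sub_eq_zero]
    congr 1
    simp only
    have hp₃ : (p : ℕ) ≠ i := fun h => hp₁ (Fin.ext h)
    have hp₄ : (p : ℕ) ≠ i + 1 := fun h => hp₂ (Fin.ext h)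
    rcases lt_or_ge (p : ℕ) i with h | h
    · have f₁ : coprodFactor n p i.castSucc = matKInv n := by
        rw [coprodFactor, if_neg, if_neg hp₁.symm]
        simp only [Fin.lt_def, Fin.val_castSucc]; omega
      have f₂ : coprodFactor n p i.succ = matKInv n := by
        rw [coprodFactor, if_neg, if_neg hp₂.symm]
        simp only [Fin.lt_def, Fin.val_succ]; omega
      rw [f₁, f₂, (commute_braiding_matKInv n ε).eq]
    · have f₁ : coprodFactor n p i.castSucc = 1 := by
        rw [coprodFactor, if_pos]
        simp only [Fin.lt_def, Fin.val_castSucc]; omega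
      have f₂ : coprodFactor n p i.succ = 1 := by
        rw [coprodFactor, if_pos]
        simp only [Fin.lt_def, Fin.val_succ]; omega
      rw [f₁, f₂, Matrix.one_kronecker_one, one_mul, mul_one]

theorem commute_braidOp_tensorF (n : ℕ) (β : BraidWord m) :
    Commute (tensorF (m + 1) n) (braidOp n β) := by
  refine Commute.list_prod_right _ _ fun M hM => ?_
  rw [List.mem_reverse, List.mem_map] at hM
  obtain ⟨g, -, rfl⟩ := hM
  exact commute_letterOp_tensorF n g

/-! ### The partial quantum trace -/

theorem tensorF_succ_apply (n : ℕ) (b i : Fin (n + 1)) (z x : Fin m → Fin (n + 1)) :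
    tensorF (m + 1) n (Fin.cons b z) (Fin.cons i x) =
      matF n b i * tensorMat n (fun _ => matKInv n) z x +
        (1 : Matrix (Fin (n + 1)) (Fin (n + 1)) 𝕂) b i * tensorF m n z x := by
  simp only [tensorF, Matrix.sum_apply, tensorMat, Fin.sum_univ_succ, Fin.prod_univ_succ,
    Fin.cons_zero, Fin.cons_succ, coprodFactor, lt_self_iff_false, if_false, if_true,
    Fin.not_lt_zero, Fin.succ_ne_zero, Fin.succ_lt_succ_iff, Fin.succ_inj, Fin.succ_pos,
    Finset.mul_sum]

theorem tensorMat_matKInv (n : ℕ) (z x : Fin m → Fin (n + 1)) :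
    tensorMat n (fun _ => matKInv n) z x =
      if z = x then ∏ p, vv ^ (-wt n (x p)) else 0 := by
  split_ifs with h
  · subst h
    simp [tensorMat, matKInv]
  · obtain ⟨p, hp⟩ := Function.ne_iff.1 h
    refine Finset.prod_eq_zero (Finset.mem_univ p) ?_
    exact Matrix.diagonal_apply_ne _ hp

theorem sum_cons {X : Type} [Fintype X] {L : ℕ} (φ : (Fin (L + 1) → X) → 𝕂) :
    ∑ y, φ y = ∑ b, ∑ z : Fin L → X, φ (Fin.cons b z) := by
  rw [← Fintype.sum_prod_type' (fun b z => φ (Fin.cons b z))]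
  exact ((Fin.consEquiv fun _ => X).sum_comp φ).symm

/-- The operator of a long component projection commutes with the action of `F`: in the partial
trace of the commutation relation of the closed braid the contributions of `1 ⊗ F` cancel by
cyclicity, and those of `F ⊗ K⁻¹` give partial quantum traces. -/
theorem tangleOp_mul_matF (n : ℕ) (β : BraidWord m) :
    tangleOp n β * matF n = matF n * tangleOp n β := by
  ext a i
  have h₁ : ∑ x : Fin m → Fin (n + 1),
      (braidOp n β * tensorF (m + 1) n) (Fin.cons a x) (Fin.cons i x) =
      (tangleOp n β * matF n) a i + ∑ x : Fin m → Fin (n + 1), ∑ z : Fin m → Fin (n + 1),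
        braidOp n β (Fin.cons a x) (Fin.cons i z) * tensorF m n z x := by
    simp only [Matrix.mul_apply, sum_cons, tensorF_succ_apply, mul_add, Finset.sum_add_distrib,
      tensorMat_matKInv, Matrix.one_apply]
    congr 1
    · rw [Finset.sum_comm]
      refine Finset.sum_congr rfl fun b _ => ?_
      simp only [tangleOp, mul_ite, mul_zero, Finset.sum_ite_eq', Finset.mem_univ, if_true,
        Finset.sum_mul]
      exact Finset.sum_congr rfl fun x _ => by ring
    · refine Finset.sum_congr rfl fun x _ => ?_
      rw [Finset.sum_comm]
      simp
  have h₂ : ∑ x : Fin m → Fin (n + 1),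
      (tensorF (m + 1) n * braidOp n β) (Fin.cons a x) (Fin.cons i x) =
      (matF n * tangleOp n β) a i + ∑ x : Fin m → Fin (n + 1), ∑ z : Fin m → Fin (n + 1),
        tensorF m n x z * braidOp n β (Fin.cons a z) (Fin.cons i x) := by
    simp only [Matrix.mul_apply, sum_cons, tensorF_succ_apply, add_mul, Finset.sum_add_distrib,
      tensorMat_matKInv, Matrix.one_apply]
    congr 1
    · rw [Finset.sum_comm]
      refine Finset.sum_congr rfl fun b _ => ?_
      simp only [tangleOp, mul_ite, mul_zero, ite_mul, zero_mul, Finset.sum_ite_eq,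
        Finset.mem_univ, if_true, Finset.mul_sum]
      exact Finset.sum_congr rfl fun x _ => by ring
    · refine Finset.sum_congr rfl fun x _ => ?_
      rw [Finset.sum_comm]
      simp
  have h₃ : ∑ x : Fin m → Fin (n + 1), ∑ z : Fin m → Fin (n + 1),
        braidOp n β (Fin.cons a x) (Fin.cons i z) * tensorF m n z x =
      ∑ x : Fin m → Fin (n + 1), ∑ z : Fin m → Fin (n + 1),
        tensorF m n x z * braidOp n β (Fin.cons a z) (Fin.cons i x) := by
    rw [Finset.sum_comm]
    simp only [mul_comm]
  rw [(commute_braidOp_tensorF n β).eq, h₁, h₃] at h₂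
  exact add_right_cancel h₂

/-- The diagonal entries of the endomorphism that belongs to a long component projection agree. -/
theorem tangleOp_apply_self (n : ℕ) (β : BraidWord m) (i : Fin (n + 1)) :
    tangleOp n β i i = tangleOp n β 0 0 := by
  induction i using Fin.induction with
  | zero => rfl
  | succ i ih =>
    rw [← ih]
    have h := congrFun (congrFun (tangleOp_mul_matF n β) i.succ) i.castSucc
    rw [Matrix.mul_apply, Matrix.mul_apply, Finset.sum_eq_single i.succ,
      Finset.sum_eq_single i.castSucc] at h
    · have hF : matF n i.succ i.castSucc ≠ 0 := by
        simp only [matF, Fin.val_succ, Fin.val_castSucc, if_true]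
        exact qInt_ne_zero (by omega)
      rw [mul_comm] at h
      exact mul_left_cancel₀ hF h
    · intro j _ hj
      rw [matF, if_neg, zero_mul]
      exact fun h => hj (Fin.ext (by simp only [Fin.val_succ, Fin.val_castSucc] at h ⊢; omega))
    · simp
    · intro j _ hj
      rw [matF, if_neg, mul_zero]
      exact fun h => hj (Fin.ext (by simp only [Fin.val_succ, Fin.val_castSucc] at h ⊢; omega))
    · simp

/-! ### Matrix entries of the `R`-matrix -/

theorem qFactorial_eq (r : ℕ) : qFactorial r = qPochhammer r r / qBracket 1 ^ r := by
  have h₁ := qBracket_ne_zero one_ne_zero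
  induction r with
  | zero => simp [qFactorial, qPochhammer]
  | succ r ih =>
    rw [qFactorial_succ, ih, qPochhammer_self_succ, qInt, pow_succ]
    field_simp

theorem matR_apply (n : ℕ) (a b i j : Fin (n + 1)) :
    matR n (a, b) (i, j) =
      if (a : ℕ) ≤ i ∧ (i : ℕ) + j = a + b then fPlus n i j (i - a) else 0 := by
  have h₁ := qBracket_ne_zero one_ne_zero
  rw [matR, cartanPart, Matrix.mul_diagonal, Matrix.sum_apply]
  simp only [Matrix.smul_apply, Matrix.kroneckerMap_apply, matE_pow_apply, matF_pow_apply,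
    smul_eq_mul]
  split_ifs with h
  · obtain ⟨r, hr⟩ : ∃ r, (i : ℕ) = a + r := ⟨i - a, by omega⟩
    have hb : (b : ℕ) = j + r := by omega
    have hi : (i : ℕ) - a = r := by omega
    -- Only the summand whose index is the jump contributes.
    rw [Finset.sum_eq_single r]
    · have h₂ := qPochhammer_self_ne_zero r
      have h₃ : (tRoot ^ (-1 * (wt n i * wt n j)) : 𝕂) * tRoot ^ (-((r : ℤ) * (r - 1))) =
          tRoot ^ (-(((n : ℤ) - 2 * (i : ℕ)) * (n - 2 * (j : ℕ)) + r * (r - 1))) := by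
        rw [← zpow_add₀ tRoot_ne_zero, wt, wt]
        ring_nf
      rw [if_pos hr.symm, if_pos hb, hi, fPlus, ← h₃, qFactorial_eq, qBinomial]
      field_simp
    · intro s _ hs
      rw [if_neg (fun h => hs (by omega)), zero_mul, mul_zero]
    · intro hr'
      exact absurd (Finset.mem_range.2 (by omega)) hr'
  · rw [Finset.sum_eq_zero, zero_mul]
    intro s _
    by_cases hs : (a : ℕ) + s = i
    · rw [if_neg (show ¬ ((b : ℕ) = j + s) by omega), mul_zero, mul_zero]
    · rw [if_neg hs, zero_mul, mul_zero]

theorem matRInv_apply (n : ℕ) (a b i j : Fin (n + 1)) :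
    matRInv n (a, b) (i, j) =
      if (a : ℕ) ≤ i ∧ (i : ℕ) + j = a + b then fMinus n j i (i - a) else 0 := by
  have h₁ := qBracket_ne_zero one_ne_zero
  rw [matRInv, cartanPart, Matrix.diagonal_mul, Matrix.sum_apply]
  simp only [Matrix.smul_apply, Matrix.kroneckerMap_apply, matE_pow_apply, matF_pow_apply,
    smul_eq_mul]
  split_ifs with h
  · obtain ⟨r, hr⟩ : ∃ r, (i : ℕ) = a + r := ⟨i - a, by omega⟩
    have hb : (b : ℕ) = j + r := by omega
    have hi : (i : ℕ) - a = r := by omega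
    -- Only the summand whose index is the jump contributes.
    rw [Finset.sum_eq_single r]
    · have h₂ := qPochhammer_self_ne_zero r
      have h₃ : (tRoot ^ (1 * (wt n a * wt n b)) : 𝕂) * tRoot ^ ((r : ℤ) * (r - 1)) =
          tRoot ^ (((n : ℤ) - 2 * (j : ℕ) - 2 * r) * (n - 2 * (i : ℕ) + 2 * r) +
            r * (r - 1)) := by
        rw [← zpow_add₀ tRoot_ne_zero, wt, wt, hb, hr]
        congr 1
        push_cast
        ring
      rw [if_pos hr.symm, if_pos hb, hi, fMinus, ← h₃, qFactorial_eq, qBinomial]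
      field_simp
    · intro s _ hs
      rw [if_neg (fun h => hs (by omega)), zero_mul, mul_zero]
    · intro hr'
      exact absurd (Finset.mem_range.2 (by omega)) hr'
  · rw [Finset.sum_eq_zero, mul_zero]
    intro s _
    by_cases hs : (a : ℕ) + s = i
    · rw [if_neg (show ¬ ((b : ℕ) = j + s) by omega), mul_zero, mul_zero]
    · rw [if_neg hs, zero_mul, mul_zero]

/-! ### Expansion of the operator of a braid into a state sum -/

/-- The matrix entries of a product of letters are sums over paths of basis elements. -/
theorem braidOp_apply (n : ℕ) (β : BraidWord m) (y x : Fin (m + 1) → Fin (n + 1)) :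
    braidOp n β y x = ∑ γ : Fin (β.length + 1) → (Fin (m + 1) → Fin (n + 1)),
      if γ 0 = x ∧ γ (Fin.last _) = y then
        ∏ k : Crossing β, letterOp n (β.get k) (γ k.succ) (γ k.castSucc) else 0 := by
  induction β generalizing x with
  | nil =>
    refine Eq.trans ?_ ((Equiv.funUnique (Fin 1) (Fin (m + 1) → Fin (n + 1))).symm.sum_comp _)
    have h0 : braidOp n ([] : BraidWord m) = 1 := rfl
    rw [h0, Matrix.one_apply]
    by_cases h : y = x
    · subst h
      rw [if_pos rfl, Finset.sum_eq_single y]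
      · exact (if_pos ⟨rfl, rfl⟩).symm
      · intro z _ hz
        exact if_neg fun h => hz h.1
      · simp
    · rw [if_neg h, Finset.sum_eq_zero]
      intro z _
      exact if_neg fun h' => h (h'.2.symm.trans h'.1)
  | cons g β ih =>
    have hp : braidOp n (g :: β) = braidOp n β * letterOp n g := by
      simp [braidOp]
    rw [hp, Matrix.mul_apply]
    refine Eq.trans ?_ (sum_cons _).symm
    refine Eq.trans ?_ (Finset.sum_eq_single x ?_ ?_).symm
    · simp only [ih, Finset.sum_mul]
      rw [Finset.sum_comm]
      refine Finset.sum_congr rfl fun γ _ => ?_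
      rw [Finset.sum_eq_single (γ 0)]
      · by_cases h : γ (Fin.last _) = y
        · rw [if_pos ⟨rfl, h⟩, if_pos ⟨rfl, h⟩]
          exact (mul_comm _ _).trans (Fin.prod_univ_succ fun k : Fin (β.length + 1) =>
            letterOp n ((g :: β).get k) ((Fin.cons x γ : Fin (β.length + 1 + 1) → _) k.succ)
              ((Fin.cons x γ : Fin (β.length + 1 + 1) → _) k.castSucc)).symm
        · rw [if_neg fun h' => h h'.2, zero_mul]
          exact (if_neg fun h' => h h'.2).symm
      · intro z _ hz
        rw [if_neg fun h => hz h.1.symm, zero_mul]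
      · simp
    · intro z _ hz
      exact Finset.sum_eq_zero fun γ _ => if_neg fun h => hz h.1
    · simp

instance (β : BraidWord m) : Fintype (PartArc β) := Fintype.ofFinite _

instance (β : BraidWord m) : DecidableEq (PartArc β) := Classical.decEq _

/-- The matrix entry at a crossing of a coloring of the part arcs by basis elements. -/
def crossingEntry (n : ℕ) (β : BraidWord m) (k : Crossing β) (S : PartArc β → Fin (n + 1)) : 𝕂 :=
  braiding n (sgn β k)
    (S (partArc β (k.succ, (gen β k).castSucc)), S (partArc β (k.succ, (gen β k).succ)))
    (S (partArc β (k.castSucc, (gen β k).castSucc)), S (partArc β (k.castSucc, (gen β k).succ)))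

/-- The diagonal entries of the endomorphism of a long component projection are sums over the
colorings of the part arcs. -/
theorem tangleOp_apply_self_eq_sum (n : ℕ) (β : BraidWord m) (i : Fin (n + 1)) :
    tangleOp n β i i = ∑ S : PartArc β → Fin (n + 1),
      if S (closureArc β 0) = i then
        (∏ k, crossingEntry n β k S) * ∏ p : Fin m, vv ^ (-wt n (S (closureArc β p.succ)))
      else 0 := by
  have h₁ : tangleOp n β i i = ∑ γ : Fin (β.length + 1) → (Fin (m + 1) → Fin (n + 1)),
      if γ 0 0 = i ∧ γ (Fin.last _) = γ 0 then
        (∏ k : Crossing β, letterOp n (β.get k) (γ k.succ) (γ k.castSucc)) *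
          ∏ p : Fin m, vv ^ (-wt n (γ 0 p.succ)) else 0 := by
    simp only [tangleOp, braidOp_apply, Finset.mul_sum]
    rw [Finset.sum_comm]
    refine Finset.sum_congr rfl fun γ _ => ?_
    rw [Finset.sum_eq_single (Fin.tail (γ 0))]
    · by_cases h : γ 0 0 = i
      · have hc : (Fin.cons i (Fin.tail (γ 0)) : Fin (m + 1) → Fin (n + 1)) = γ 0 := by
          rw [← h]; exact Fin.cons_self_tail _
        rw [hc]
        by_cases h' : γ (Fin.last _) = γ 0
        · rw [if_pos ⟨rfl, h'⟩, if_pos ⟨h, h'⟩, mul_comm]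
          rfl
        · rw [if_neg fun h => h' h.2, if_neg fun h => h' h.2, mul_zero]
      · rw [if_neg, if_neg fun h' => h h'.1, mul_zero]
        intro h'
        exact h (by rw [h'.1, Fin.cons_zero])
    · intro x _ hx
      rw [if_neg, mul_zero]
      intro h'
      exact hx (by rw [h'.1, Fin.tail_cons])
    · simp
  rw [h₁]
  symm
  have hlast : ∀ p, partArc β (Fin.last _, p) = partArc β (0, p) := fun p =>
    Quot.sound (Joined.closing p)
  refine Fintype.sum_of_injective (fun S l p => S (partArc β (l, p))) ?_ _ _ ?_ ?_
  · intro S T h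
    funext e
    obtain ⟨⟨l, p⟩, rfl⟩ := Quot.exists_rep e
    exact congrFun (congrFun h l) p
  · -- A contributing path is constant along pieces without crossings.
    intro γ hγ
    by_contra hne
    apply hγ
    have hc : γ 0 0 = i ∧ γ (Fin.last _) = γ 0 := by
      by_contra h
      exact hne (if_neg h)
    rw [if_pos hc] at hne
    have hk := Finset.prod_ne_zero_iff.1 (left_ne_zero_of_mul hne)
    have hJ : ∀ u w, Joined β u w → γ u.1 u.2 = γ w.1 w.2 := by
      rintro _ _ (⟨k, p, hp₁, hp₂⟩ | p)
      · by_contra h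
        refine hk k (Finset.mem_univ k) ?_
        rw [letterOp, if_neg]
        exact fun h' => h (h' p hp₁ hp₂).symm
      · exact congrFun hc.2 p
    exact ⟨Quot.lift (fun u => γ u.1 u.2) hJ, rfl⟩
  · intro S
    have hs : (fun p => S (partArc β (Fin.last β.length, p))) = fun p => S (partArc β (0, p)) := by
      funext p
      rw [hlast]
    by_cases h : S (closureArc β 0) = i
    · rw [if_pos h, if_pos ⟨h, hs⟩]
      congr 1
      refine Finset.prod_congr rfl fun k _ => ?_
      rw [letterOp, if_pos]
      · rfl
      · intro p hp₁ hp₂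
        exact congrArg S (Quot.sound (Joined.through k p hp₁ hp₂)).symm
    · rw [if_neg h, if_neg fun h' => h h'.1]

/-! ### The state sums for the two orientations -/

theorem stateSum_rMatrixModel_eq_finsum (o : Orient) (n : ℕ) (β : BraidWord m) :
    (rMatrixModel o n).stateSum ⟨m, β⟩ = ∑ᶠ s ∈ partStates o n β,
      (∏ k, crossingFactor o n β k s) *
        ∏ p : Fin m, vv ^ extremumExp o n (s (closureArc β p.succ)) :=
  finsum_mem_congr rfl fun s _ => rMatrixModel_contribution o n β s

theorem stateSum_rMatrixModel (o : Orient) (n : ℕ) (β : BraidWord m) :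
    (rMatrixModel o n).stateSum ⟨m, β⟩ = ∑ S : PartArc β → Fin (n + 1),
      open Classical in
      if (fun e => (S e : ℕ)) ∈ partStates o n β then
        (∏ k, crossingFactor o n β k (fun e => (S e : ℕ))) *
          ∏ p : Fin m, vv ^ extremumExp o n (S (closureArc β p.succ) : ℕ) else 0 := by
  classical
  have hinj : Function.Injective (fun (S : PartArc β → Fin (n + 1)) e => (S e : ℕ)) :=
    fun S T h => funext fun e => Fin.ext (congrFun h e)
  have himg : partStates o n β = (fun (S : PartArc β → Fin (n + 1)) e => (S e : ℕ)) ''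
      {S | (fun e => (S e : ℕ)) ∈ partStates o n β} := by
    ext s
    refine ⟨fun hs => ⟨fun e => ⟨s e, Nat.lt_succ_of_le (hs.1 e)⟩, hs, rfl⟩, ?_⟩
    rintro ⟨S, hS, rfl⟩
    exact hS
  rw [stateSum_rMatrixModel_eq_finsum]
  conv_lhs => rw [himg]
  rw [finsum_mem_image hinj.injOn, finsum_mem_def, finsum_eq_sum_of_fintype]
  exact Finset.sum_congr rfl fun S _ => rfl

/-- The matrix entry at a crossing is the local factor of the upwards oriented state model, and
vanishes at colorings that violate the conditions on states. -/
theorem crossingEntry_eq (n : ℕ) (β : BraidWord m) (k : Crossing β)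
    (S : PartArc β → Fin (n + 1)) :
    crossingEntry n β k S =
      if (S (overOut β k) : ℕ) ≤ S (overIn β k) ∧
        (S (overIn β k) : ℕ) + S (underIn β k) = S (overOut β k) + S (underOut β k) then
        crossingFactor .up n β k (fun e => (S e : ℕ)) else 0 := by
  simp only [crossingEntry, crossingFactor, overSrc, overTgt, underSrc, overOut, overIn, underIn,
    underOut]
  rcases Int.units_eq_one_or (sgn β k) with h | h
  · simp only [h, if_true, braiding, matR_apply]
  · have h' : ¬ ((-1 : ℤˣ) = 1) := by decide
    simp only [h, h', if_false, braiding, matRInv_apply]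

theorem coloredJones_eq_stateSum_up (n : ℕ) (β : BraidWord m) :
    coloredJones n β = (rMatrixModel .up n).stateSum ⟨m, β⟩ := by
  classical
  rw [coloredJones, tangleOp_apply_self_eq_sum, stateSum_rMatrixModel]
  refine Finset.sum_congr rfl fun S _ => ?_
  simp only [crossingEntry_eq, Finset.prod_ite_zero, ite_mul, zero_mul, ← ite_and]
  refine if_congr ?_ ?_ rfl
  · simp only [partStates, Set.mem_ofPred_eq, overSrc, overTgt, underSrc, underTgt, Fin.ext_iff,
      Fin.val_zero, Finset.mem_univ, true_imp_iff, forall_and]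
    have : ∀ e, (S e : ℕ) ≤ n := fun e => Nat.le_of_lt_succ (S e).2
    tauto
  · congr 1
    refine Finset.prod_congr rfl fun p _ => ?_
    rw [extremumExp, wt]
    ring_nf

/-! ### Reversal of the orientation

Rotating the picture reverses the orientation and exchanges the highest and the lowest weight
vector, so that the color `a` becomes `n - a`.  The local factors agree up to a diagonal
change of basis of the representation. -/

/-- The diagonal change of basis that compares the two orientations. -/
def gauge (n a : ℕ) : 𝕂 :=
  qPochhammer a a * qPochhammer (n - a : ℕ) (n - a) * tRoot ^ (-(2 * (a : ℤ) ^ 2))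

theorem gauge_ne_zero (n a : ℕ) : gauge n a ≠ 0 :=
  mul_ne_zero (mul_ne_zero (qPochhammer_self_ne_zero _) (qPochhammer_self_ne_zero _))
    (zpow_ne_zero _ tRoot_ne_zero)

theorem qPochhammer_add_eq_div (k r : ℕ) :
    qPochhammer (k + r) r = qPochhammer (k + r : ℕ) (k + r) / qPochhammer k k := by
  rw [eq_div_iff (qPochhammer_self_ne_zero k), qPochhammer_add_mul]

/-- The products of quantum integers in the local factors of the two orientations. -/
theorem qBinomial_mul_qPochhammer_gauge (a b c d r : ℕ) :
    qBinomial (c + r) r * qPochhammer (a + r) r *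
        ((qPochhammer a a * qPochhammer (d + r : ℕ) (d + r)) *
          (qPochhammer (b + r : ℕ) (b + r) * qPochhammer c c)) =
      qBinomial (b + r) r * qPochhammer (d + r) r *
        ((qPochhammer b b * qPochhammer (c + r : ℕ) (c + r)) *
          (qPochhammer (a + r : ℕ) (a + r) * qPochhammer d d)) := by
  have h₁ := qPochhammer_self_ne_zero a
  have h₂ := qPochhammer_self_ne_zero b
  have h₃ := qPochhammer_self_ne_zero c
  have h₄ := qPochhammer_self_ne_zero d
  have h₅ := qPochhammer_self_ne_zero r
  rw [qBinomial_eq, qBinomial_eq, qPochhammer_add_eq_div, qPochhammer_add_eq_div]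
  field_simp

/-- At a positive crossing rotated by a half turn, `a` is the color of the incoming overcrossing
and `b` that of the outgoing undercrossing part arc of the upwards oriented braid. -/
theorem fPlus_gauge {n a b r : ℕ} (ha : a + r ≤ n) (hb : b + r ≤ n) :
    fPlus n (n - a) (n - (b + r)) r * (gauge n a * gauge n (b + r)) =
      fPlus n (a + r) b r * (gauge n b * gauge n (a + r)) := by
  obtain ⟨d, hd⟩ := Nat.exists_eq_add_of_le ha
  obtain ⟨c, hc⟩ := Nat.exists_eq_add_of_le hb
  have e₁ : n - a = d + r := by omega
  have e₂ : n - (b + r) = c := by omega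
  have e₃ : n - b = c + r := by omega
  have e₄ : n - (a + r) = d := by omega
  have e₅ : (n : ℤ) + r - (d + r : ℕ) = a + r := by omega
  have e₆ : (n : ℤ) + r - (a + r : ℕ) = d + r := by omega
  have h := qBinomial_mul_qPochhammer_gauge a b c d r
  have ht : tRoot ^ (-(((n : ℤ) - 2 * (d + r : ℕ)) * (n - 2 * c) + r * (r - 1))) *
      (tRoot ^ (-(2 * (a : ℤ) ^ 2)) * tRoot ^ (-(2 * ((b + r : ℕ) : ℤ) ^ 2))) =
      tRoot ^ (-(((n : ℤ) - 2 * (a + r : ℕ)) * (n - 2 * b) + r * (r - 1))) *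
      (tRoot ^ (-(2 * (b : ℤ) ^ 2)) * tRoot ^ (-(2 * ((a + r : ℕ) : ℤ) ^ 2))) := by
    simp only [← zpow_add₀ tRoot_ne_zero]
    congr 1
    have f₁ : (c : ℤ) = n - b - r := by omega
    have f₂ : (d : ℤ) = n - a - r := by omega
    push_cast
    rw [f₁, f₂]
    ring
  simp only [fPlus, gauge, e₁, e₂, e₃, e₄, e₅, e₆]
  generalize tRoot ^ (-(((n : ℤ) - 2 * (d + r : ℕ)) * (n - 2 * c) + r * (r - 1))) = t₁ at *
  generalize tRoot ^ (-(2 * (a : ℤ) ^ 2)) = t₂ at *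
  generalize tRoot ^ (-(2 * ((b + r : ℕ) : ℤ) ^ 2)) = t₃ at *
  generalize tRoot ^ (-(((n : ℤ) - 2 * (a + r : ℕ)) * (n - 2 * b) + r * (r - 1))) = t₄ at *
  generalize tRoot ^ (-(2 * (b : ℤ) ^ 2)) = t₅ at *
  generalize tRoot ^ (-(2 * ((a + r : ℕ) : ℤ) ^ 2)) = t₆ at *
  linear_combination ((-1) ^ r * (t₁ * (t₂ * t₃))) * h + ((-1) ^ r *
    (qBinomial (b + r) r * qPochhammer (d + r) r *
        ((qPochhammer b b * qPochhammer (c + r : ℕ) (c + r)) *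
          (qPochhammer (a + r : ℕ) (a + r) * qPochhammer d d)))) * ht

/-- The counterpart of `fPlus_gauge` at a negative crossing. -/
theorem fMinus_gauge {n a b r : ℕ} (ha : a + r ≤ n) (hb : b + r ≤ n) :
    fMinus n (n - (b + r)) (n - a) r * (gauge n a * gauge n (b + r)) =
      fMinus n b (a + r) r * (gauge n b * gauge n (a + r)) := by
  obtain ⟨d, hd⟩ := Nat.exists_eq_add_of_le ha
  obtain ⟨c, hc⟩ := Nat.exists_eq_add_of_le hb
  have e₁ : n - a = d + r := by omega
  have e₂ : n - (b + r) = c := by omega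
  have e₃ : n - b = c + r := by omega
  have e₄ : n - (a + r) = d := by omega
  have e₅ : (n : ℤ) + r - (d + r : ℕ) = a + r := by omega
  have e₆ : (n : ℤ) + r - (a + r : ℕ) = d + r := by omega
  have h := qBinomial_mul_qPochhammer_gauge a b c d r
  have ht : tRoot ^ (((n : ℤ) - 2 * c - 2 * r) * (n - 2 * (d + r : ℕ) + 2 * r) + r * (r - 1)) *
      (tRoot ^ (-(2 * (a : ℤ) ^ 2)) * tRoot ^ (-(2 * ((b + r : ℕ) : ℤ) ^ 2))) =
      tRoot ^ (((n : ℤ) - 2 * b - 2 * r) * (n - 2 * (a + r : ℕ) + 2 * r) + r * (r - 1)) *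
      (tRoot ^ (-(2 * (b : ℤ) ^ 2)) * tRoot ^ (-(2 * ((a + r : ℕ) : ℤ) ^ 2))) := by
    simp only [← zpow_add₀ tRoot_ne_zero]
    congr 1
    have f₁ : (c : ℤ) = n - b - r := by omega
    have f₂ : (d : ℤ) = n - a - r := by omega
    push_cast
    rw [f₁, f₂]
    ring
  simp only [fMinus, gauge, e₁, e₂, e₃, e₄, e₅, e₆]
  generalize tRoot ^ (((n : ℤ) - 2 * c - 2 * r) * (n - 2 * (d + r : ℕ) + 2 * r) +
    r * (r - 1)) = t₁ at *
  generalize tRoot ^ (-(2 * (a : ℤ) ^ 2)) = t₂ at *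
  generalize tRoot ^ (-(2 * ((b + r : ℕ) : ℤ) ^ 2)) = t₃ at *
  generalize tRoot ^ (((n : ℤ) - 2 * b - 2 * r) * (n - 2 * (a + r : ℕ) + 2 * r) +
    r * (r - 1)) = t₄ at *
  generalize tRoot ^ (-(2 * (b : ℤ) ^ 2)) = t₅ at *
  generalize tRoot ^ (-(2 * ((a + r : ℕ) : ℤ) ^ 2)) = t₆ at *
  linear_combination (t₁ * (t₂ * t₃)) * h +
    (qBinomial (b + r) r * qPochhammer (d + r) r *
        ((qPochhammer b b * qPochhammer (c + r : ℕ) (c + r)) *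
          (qPochhammer (a + r : ℕ) (a + r) * qPochhammer d d))) * ht

theorem crossingEntry_rev (n : ℕ) (β : BraidWord m) (k : Crossing β)
    (S : PartArc β → Fin (n + 1)) :
    crossingEntry n β k (fun e => (S e).rev) *
        (gauge n (S (overIn β k)) * gauge n (S (underIn β k))) =
      (if (S (overIn β k) : ℕ) ≤ S (overOut β k) ∧
        (S (overOut β k) : ℕ) + S (underOut β k) = S (overIn β k) + S (underIn β k) then
        crossingFactor .down n β k (fun e => (S e : ℕ)) else 0) *
        (gauge n (S (underOut β k)) * gauge n (S (overOut β k))) := by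
  have b₁ := (S (overIn β k)).2
  have b₂ := (S (overOut β k)).2
  have b₃ := (S (underIn β k)).2
  have b₄ := (S (underOut β k)).2
  have hc : (((S (overOut β k)).rev : ℕ) ≤ (S (overIn β k)).rev ∧
      ((S (overIn β k)).rev : ℕ) + (S (underIn β k)).rev =
        (S (overOut β k)).rev + (S (underOut β k)).rev) ↔
      (S (overIn β k) : ℕ) ≤ S (overOut β k) ∧
        (S (overOut β k) : ℕ) + S (underOut β k) = S (overIn β k) + S (underIn β k) := by
    simp only [Fin.val_rev]
    omega
  rw [crossingEntry_eq]
  by_cases h : (S (overIn β k) : ℕ) ≤ S (overOut β k) ∧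
      (S (overOut β k) : ℕ) + S (underOut β k) = S (overIn β k) + S (underIn β k)
  · rw [if_pos h, if_pos (hc.2 h)]
    obtain ⟨h₁, h₂⟩ := h
    obtain ⟨r, hr⟩ := Nat.exists_eq_add_of_le h₁
    have hr' : (S (underIn β k) : ℕ) = S (underOut β k) + r := by omega
    have e (x : ℕ) : n + 1 - (x + 1) = n - x := by omega
    have e' : n - (S (overIn β k) : ℕ) - (n - S (overOut β k)) = r := by omega
    simp only [crossingFactor, overSrc, overTgt, underSrc, Fin.val_rev, e]
    rw [e', hr, hr', Nat.add_sub_cancel_left]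
    split_ifs
    · exact fPlus_gauge (by omega) (by omega)
    · exact fMinus_gauge (by omega) (by omega)
  · rw [if_neg h, if_neg (fun h' => h (hc.1 h')), zero_mul, zero_mul]

theorem prod_gauge (n : ℕ) (β : BraidWord m) (S : PartArc β → Fin (n + 1)) :
    ∏ k, (gauge n (S (underOut β k)) * gauge n (S (overOut β k))) =
      ∏ k, (gauge n (S (overIn β k)) * gauge n (S (underIn β k))) := by
  have h := prod_crossings_eq_one β
    (fun _ e => Units.mk0 (gauge n (S e)) (gauge_ne_zero n (S e)))
  rw [Finset.prod_div_distrib, div_eq_one] at h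
  have h' := congrArg (Units.val) h
  simp only [Units.coe_prod, Units.val_mul, Units.val_mk0] at h'
  convert h' using 2 with k _ k _
  · unfold underOut overOut
    split_ifs
    · rfl
    · exact mul_comm _ _
  · unfold overIn underIn
    split_ifs
    · rfl
    · exact mul_comm _ _

/-- Around the closed braid the diagonal changes of basis cancel. -/
theorem prod_crossingEntry_rev (n : ℕ) (β : BraidWord m) (S : PartArc β → Fin (n + 1)) :
    ∏ k, crossingEntry n β k (fun e => (S e).rev) =
      ∏ k, if (S (overIn β k) : ℕ) ≤ S (overOut β k) ∧
        (S (overOut β k) : ℕ) + S (underOut β k) = S (overIn β k) + S (underIn β k) then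
        crossingFactor .down n β k (fun e => (S e : ℕ)) else 0 := by
  have h : ∏ k, (gauge n (S (overIn β k)) * gauge n (S (underIn β k))) ≠ 0 :=
    Finset.prod_ne_zero_iff.2 fun k _ => mul_ne_zero (gauge_ne_zero _ _) (gauge_ne_zero _ _)
  refine mul_right_cancel₀ h ?_
  rw [← Finset.prod_mul_distrib, Finset.prod_congr rfl fun k _ => crossingEntry_rev n β k S,
    Finset.prod_mul_distrib, prod_gauge]

/-- The state sum of the downwards oriented braid is the diagonal entry at the lowest weight
vector. -/
theorem stateSum_down_eq (n : ℕ) (β : BraidWord m) :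
    (rMatrixModel .down n).stateSum ⟨m, β⟩ = tangleOp n β (Fin.last n) (Fin.last n) := by
  classical
  rw [tangleOp_apply_self_eq_sum, stateSum_rMatrixModel]
  refine Eq.trans ?_
    ((Equiv.arrowCongr (Equiv.refl (PartArc β)) (Fin.revPerm (n := n + 1))).sum_comp _)
  refine Finset.sum_congr rfl fun S _ => ?_
  have hS : Equiv.arrowCongr (Equiv.refl (PartArc β)) (Fin.revPerm (n := n + 1)) S =
      fun e => (S e).rev := rfl
  simp only [hS, prod_crossingEntry_rev, Finset.prod_ite_zero, ite_mul, zero_mul, ← ite_and]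
  refine if_congr ?_ ?_ rfl
  · simp only [partStates, Set.mem_ofPred_eq, overSrc, overTgt, underSrc, underTgt,
      Finset.mem_univ, true_imp_iff, forall_and]
    have h0 : (S (closureArc β 0)).rev = Fin.last n ↔ (S (closureArc β 0) : ℕ) = 0 := by
      rw [Fin.rev_eq_iff, Fin.rev_last, Fin.ext_iff, Fin.val_zero]
    rw [h0]
    have : ∀ e, (S e : ℕ) ≤ n := fun e => Nat.le_of_lt_succ (S e).2
    tauto
  · congr 1
    refine Finset.prod_congr rfl fun p _ => ?_
    congr 1
    have := (S (closureArc β p.succ)).2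
    simp only [extremumExp, wt, Fin.val_rev]
    omega

theorem coloredJones_eq_finsum (n : ℕ) (β : BraidWord m) :
    coloredJones n β = ∑ᶠ f ∈ arcStates n β,
      tRoot ^ fourDeltaPrime n β * (tt ^ delta β f * ∏ k, vertexFactor n β f k) := by
  rw [coloredJones, ← tangleOp_apply_self n β (Fin.last n), ← stateSum_down_eq,
    stateSum_rMatrixModel_eq_finsum]
  refine (finsum_mem_eq_of_bijOn (flowMap β) (flowMap_bijOn n β) fun f hf => ?_).symm
  rw [← arcModel_contribution, ← rMatrixModel_contribution]
  exact (contribution_flowMap hf).symm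

end

end ColoredJones

open ColoredJones in
theorem mainTheorem1 (n : ℕ) :
    (∀ (m : ℕ) (β : BraidWord m),
      coloredJones n β = (rMatrixModel .up n).stateSum ⟨m, β⟩ ∧
      coloredJones n β =
        tRoot ^ fourDeltaPrime n β *
          ∑ᶠ f ∈ arcStates n β,
            tt ^ delta β f *
              ∏ k : Crossing β,
                (tt ^ ((n : ℤ) * (sgn β k : ℤ) * f (.blue k)) *
                  signedBinomial (tt ^ (-(sgn β k : ℤ))) (f (.blue k) + f (.red k)) (f (.blue k)) *
                  signedPochhammer (tt ^ (sgn β k : ℤ)) ((n : ℤ) - beforeRed β f k)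
                    (f (.red k))) ∧
      coloredJones n β ∈ laurentRing ∧
      (∀ f ∈ arcStates n β, (arcModel n).contribution ⟨m, β⟩ f ∈ laurentRing) ∧
      (∀ f ∈ arcStates n β, ∀ k : Crossing β,
        flowMap β f (underOut β k) = f (.blue k) ∧
        flowMap β f (overOut β k) = flowMap β f (overIn β k) + f (.red k))) ∧
    StateModel.EquivalentOver (arcModel n) (rMatrixModel .down n) id
      (fun K => flowMap K.2) := by
  refine ⟨fun m β => ⟨coloredJones_eq_stateSum_up n β, ?_, ?_,
    fun f _ => arcModel_contribution_mem n β f,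
    fun f hf k => ⟨precedingSum_underOut β f k, flowMap_overOut hf k⟩⟩,
    arcModel_equivalentOver n⟩
  · rw [coloredJones_eq_finsum, ← mul_finsum_mem]
    rfl
  · rw [coloredJones_eq_finsum, finsum_mem_eq_finite_toFinset_sum _ (arcStates_finite n β)]
    refine sum_mem fun f _ => ?_
    rw [← arcModel_contribution]
    exact arcModel_contribution_mem n β f
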